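/- Let $a,b\ge 1$ and $n\ge 0$ be integers. All matroids are finite. **Polynomials of a matroid.** For a matroid $M$ on $E$ with rank function $\mathrm{rk}$ let $\chi_M(t)=\sum_{A\subseteq E}(-1)^{|A|}t^{\mathrm{rk}(M)-\mathrm{rk}(A)}$ be its characteristic polynomial and $\mathcal L(M)$ its lattice of flats. For $F\in\mathcal L(M)$ write $M|F$ for the restriction of $M$ to $F$ and $M/F$ for the contraction of $M$ by $F$ (which is loopless). The Kazhdan–Lusztig polynomials $P_M(t)\in\mathbb Z[t]$ of loopless matroids $M$ are the unique polynomials such that $P_M=1$ if $\mathrm{rk}(M)=0$; $\deg P_M<\tfrac12\mathrm{rk}(M)$ if $\mathrm{rk}(M)>0$; and $t^{\mathrm{rk}(M)}P_M(t^{-1})=\sum_{F\in\mathcal L(M)}\chi_{M|F}(t)\,P_{M/F}(t)$ for every loopless $M$. The $Z$-polynomial of a matroid $M$ is $$Z_M(t)=\sum_{F\in\mathcal L(M)}t^{\mathrm{rk}(M|F)}\,P_{M/F}(t).$$ **The matroids.** Let $U_n^{a,b}$ be the uniform matroid on $[n(a+b)]$ whose bases are the subsets of size $nb$. Let $S\subseteq[n(a+b)]$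 be the set whose indicator vector is $(0^a,1^b,0^a,1^b,\ldots,0^a,1^b)$ ($n$ blocks $0^a,1^b$). The $(a,b)$-Catalan matroid $C_n^{a,b}$ is the Schubert matroid of $S$: the matroid on $[n(a+b)]$ whose bases are the sets $T$ with $|T|=|S|$ such that, for every $i$, the $i$-th smallest element of $T$ is at most the $i$-th smallest element of $S$. For a partition $\lambda=(\lambda_1,\ldots,\lambda_k)\vdash n$ let $U_\lambda^{a,b}=U_{\lambda_1}^{a,b}\oplus\cdots\oplus U_{\lambda_k}^{a,b}$, and let $z_\lambda=\prod_{i=1}^n i^{\alpha_i}\alpha_i!$, where $\alpha_i$ is the number of parts of $\lambda$ equal to $i$. **Statement.** In $\mathbb Q[t]$, $$Z_{C_n^{a,b}}(t)=\sum_{\lambda\vdash n}\frac1{z_\lambda}\,Z_{U_\lambda^{a,b}}(t),$$ and, for every $\lambda=(\lambda_1,\ldots,\lambda_k)\vdash n$, $\;Z_{U_\lambda^{a,b}}(t)=\prod_{i=1}^k Z_{U_{\lambda_i}^{a,b}}(t)$. -/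

import Mathlib

open Polynomial
open scoped Matroid

/-! ### Matroid polynomials -/

/-- The rank of a finite matroid, as a natural number. -/
noncomputable def rkNat {α : Type*} (M : Matroid α) : ℕ := M.eRank.toNat

/-- The rank of a set in a finite matroid, as a natural number. -/
noncomputable def setRk {α : Type*} (M : Matroid α) (A : Set α) : ℕ := (M.eRk A).toNat

open Classical in
/-- The lattice of flats, as a finite set of sets. -/
noncomputable def flats {α : Type*} [Fintype α] (M : Matroid α) : Finset (Set α) :=
  Finset.univ.filter fun F => M.IsFlat F

open Classical in
/-- The characteristic polynomial `∑_{A ⊆ E} (-1)^|A| t^(rk M - rk A)`. -/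
noncomputable def charPoly {α : Type*} [Fintype α] (M : Matroid α) : ℤ[X] :=
  ∑ A : Set α with A ⊆ M.E, (-1) ^ A.ncard * X ^ (rkNat M - setRk M A)

/-- The part of `p` consisting of the terms of degree less than `r / 2`. -/
noncomputable def lowPart (r : ℕ) (p : ℤ[X]) : ℤ[X] :=
  ∑ i ∈ (Finset.range r).filter (fun i => 2 * i < r), monomial i (p.coeff i)

open Classical in
theorem contract_card_lt {α : Type*} [Fintype α] (M : Matroid α) {F : Set α} (hF : M.IsFlat F)
    (hne : F.Nonempty) : (M ／ F).E.toFinset.card < M.E.toFinset.card := by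
  refine Finset.card_lt_card ?_
  rw [Set.toFinset_ssubset_toFinset, Matroid.contract_ground]
  obtain ⟨x, hx⟩ := hne
  exact ⟨Set.sdiff_subset, fun h => (h (hF.subset_ground hx)).2 hx⟩

open Classical in
/-- The Kazhdan–Lusztig polynomial of a loopless matroid (and `0` for a matroid with loops).

It is characterised, on loopless matroids, by: it is `1` in rank `0`; its degree is less than half
of the rank in positive rank; and `t^(rk M) P_M(1/t) = ∑_F χ_{M|F}(t) P_{M/F}(t)`, the sum
over all flats `F`. Since the term `F = ∅` of that sum is `P_M` itself, comparing the coefficients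
of degree less than `rk M / 2` gives the recursion used here. That this recursion does
define the polynomial with these three properties is `klPoly_rank_zero`, `klPoly_degree`,
`klPoly_reflect` and `klPoly_unique` below. -/
noncomputable def klPoly {α : Type*} [Fintype α] (M : Matroid α) : ℤ[X] :=
  if M.Loopless then
    if rkNat M = 0 then 1
    else lowPart (rkNat M)
      (-∑ F : {F : Set α // M.IsFlat F ∧ F.Nonempty}, charPoly (M ↾ F.1) * klPoly (M ／ F.1))
  else 0
termination_by M.E.toFinset.card
decreasing_by exact contract_card_lt M F.2.1 F.2.2

/-- The `Z`-polynomial `∑_F t^(rk F) P_{M/F}(t)`, the sum over all flats `F` of `M`. -/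
noncomputable def zPoly {α : Type*} [Fintype α] (M : Matroid α) : ℤ[X] :=
  ∑ F ∈ flats M, X ^ rkNat (M ↾ F) * klPoly (M ／ F)

/-! ### The recursion defines the Kazhdan–Lusztig polynomial -/

section KazhdanLusztigSpec

set_option linter.unusedSectionVars false

variable {α : Type*} [Fintype α]

theorem eRk_ne_top (M : Matroid α) (A : Set α) : M.eRk A ≠ ⊤ :=
  ((M.eRk_le_encard A).trans_lt (Set.toFinite A).encard_lt_top).ne

theorem setRk_mono (M : Matroid α) {A B : Set α} (h : A ⊆ B) : setRk M A ≤ setRk M B :=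
  ENat.toNat_le_toNat (M.eRk_mono h) (eRk_ne_top M B)

theorem rkNat_eq (M : Matroid α) : rkNat M = setRk M M.E := by
  rw [rkNat, setRk, Matroid.eRk_ground]

theorem setRk_restrict (M : Matroid α) {A R : Set α} (h : A ⊆ R) :
    setRk (M ↾ R) A = setRk M A := by
  rw [setRk, setRk, Matroid.restrict_eRk_eq _ h]

theorem setRk_contract (M : Matroid α) {A F : Set α} (h : Disjoint A F) :
    setRk (M ／ F) A + setRk M F = setRk M (A ∪ F) := by
  obtain ⟨I, hI⟩ := M.exists_isBasis' F
  obtain ⟨J, hJ, hIJ⟩ := hI.indep.subset_isBasis'_of_subset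
    (hI.subset.trans (Set.subset_union_right (s := A)))
  have hJF : J ∩ F = I := (hI.eq_of_subset_indep (hJ.indep.subset Set.inter_subset_left)
    (Set.subset_inter hIJ hI.subset) Set.inter_subset_right).symm
  have hb := hJ.contract_isBasis' hI
    (hJ.indep.subset (Set.union_subset Set.sdiff_subset hIJ))
  rw [Set.union_sdiff_right, h.sdiff_eq_left] at hb
  rw [setRk, setRk, setRk, ← hb.encard_eq_eRk, ← hI.encard_eq_eRk, ← hJ.encard_eq_eRk, ← hJF,
    ← ENat.toNat_add (Set.toFinite _).encard_lt_top.ne (Set.toFinite _).encard_lt_top.ne,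
    Set.encard_sdiff_add_encard_inter]

open Classical in
/-- Cancellation of an alternating sum over sets, by toggling a fixed element `e`. -/
theorem sum_toggle {R : Type*} [CommRing R] (e : α) (p : Set α → Prop) (f : Set α → R)
    (hp : ∀ A, e ∉ A → (p (insert e A) ↔ p A)) (hf : ∀ A, e ∉ A → p A → f (insert e A) = f A) :
    ∑ A : Set α with p A, (-1) ^ A.ncard * f A = 0 := by
  have hdel : ∀ A : Set α, e ∈ A → insert e (A \ {e}) = A := fun A h => by
    rw [Set.insert_sdiff_singleton, Set.insert_eq_of_mem h]
  have hnot : ∀ A : Set α, e ∉ A \ {e} := fun A h => h.2 rfl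
  have hcard : ∀ A : Set α, e ∉ A → (-1 : R) ^ (insert e A).ncard = -(-1) ^ A.ncard := fun A h => by
    rw [Set.ncard_insert_of_notMem h, pow_succ]; ring
  refine Finset.sum_involution (fun A _ => if e ∈ A then A \ {e} else insert e A) ?_ ?_ ?_ ?_
  · intro A hA
    simp only [Finset.mem_filter, Finset.mem_univ, true_and] at hA
    by_cases h : e ∈ A
    · have h1 := hf (A \ {e}) (hnot A) ((hp _ (hnot A)).1 (by rwa [hdel A h]))
      have h2 := hcard (A \ {e}) (hnot A)
      rw [hdel A h] at h1 h2
      simp only [if_pos h]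
      rw [h1, h2]; ring
    · simp only [if_neg h]
      rw [hf A h hA, hcard A h]; ring
  · intro A _ _
    by_cases h : e ∈ A
    · simp only [if_pos h]
      exact fun h' => hnot A (h'.symm ▸ h)
    · simp only [if_neg h]
      exact fun h' => h (h' ▸ Set.mem_insert e A)
  · intro A hA
    simp only [Finset.mem_filter, Finset.mem_univ, true_and] at hA ⊢
    by_cases h : e ∈ A
    · simp only [if_pos h]
      exact (hp _ (hnot A)).1 (by rwa [hdel A h])
    · simp only [if_neg h]
      exact (hp A h).2 hA
  · intro A _
    by_cases h : e ∈ A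
    · simp only [if_pos h, if_neg (hnot A), hdel A h]
    · simp only [if_neg h, if_pos (Set.mem_insert e A)]
      ext x
      simp only [Set.mem_sdiff, Set.mem_insert_iff, Set.mem_singleton_iff]
      constructor
      · rintro ⟨rfl | hx, hne⟩
        · exact absurd rfl hne
        · exact hx
      · exact fun hx => ⟨Or.inr hx, fun hxe => h (hxe ▸ hx)⟩

open Classical in
/-- The characteristic polynomial of the minor of `M` on the interval from `F` to `G`. -/
noncomputable def intervalPoly (M : Matroid α) (F G : Set α) : ℤ[X] :=
  ∑ A : Set α with F ⊆ A ∧ A ⊆ G, (-1) ^ (A \ F).ncard * X ^ (setRk M G - setRk M A)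

theorem charPoly_minor (M : Matroid α) {F G : Set α} (hFG : F ⊆ G) :
    charPoly ((M ／ F) ↾ (G \ F)) = intervalPoly M F G := by
  classical
  rw [charPoly, intervalPoly]
  refine Finset.sum_nbij' (fun A => A ∪ F) (fun A => A \ F) ?_ ?_ ?_ ?_ ?_
  · intro A hA
    replace hA : A ⊆ G \ F := (Finset.mem_filter.1 hA).2
    simp only [Finset.mem_filter, Finset.mem_univ, true_and]
    exact ⟨Set.subset_union_right, Set.union_subset (hA.trans Set.sdiff_subset) hFG⟩
  · intro A hA
    simp only [Finset.mem_filter, Finset.mem_univ, true_and] at hA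
    exact Finset.mem_filter.2 ⟨Finset.mem_univ _, Set.sdiff_subset_sdiff_left hA.2⟩
  · intro A hA
    replace hA : A ⊆ G \ F := (Finset.mem_filter.1 hA).2
    rw [Set.union_sdiff_right]
    exact (Set.disjoint_of_subset_left hA Set.disjoint_sdiff_left).sdiff_eq_left
  · intro A hA
    simp only [Finset.mem_filter, Finset.mem_univ, true_and] at hA
    exact Set.sdiff_union_of_subset hA.1
  · intro A hA
    replace hA : A ⊆ G \ F := (Finset.mem_filter.1 hA).2
    have hd : Disjoint A F := Set.disjoint_of_subset_left hA Set.disjoint_sdiff_left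
    have h1 := setRk_contract M hd
    have h2 := setRk_contract M (Set.disjoint_sdiff_left (s := F) (t := G))
    rw [Set.sdiff_union_of_subset hFG] at h2
    rw [rkNat_eq, Matroid.restrict_ground_eq, setRk_restrict _ subset_rfl, setRk_restrict _ hA,
      Set.union_sdiff_right, hd.sdiff_eq_left]
    congr 2
    omega

theorem charPoly_restrict (M : Matroid α) (G : Set α) :
    charPoly (M ↾ G) = intervalPoly M ∅ G := by
  rw [← charPoly_minor M (Set.empty_subset G), Matroid.contract_empty, Set.sdiff_empty]

theorem reflect_finset_sum {ι : Type*} (s : Finset ι) (f : ι → ℤ[X]) (N : ℕ) :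
    reflect N (∑ i ∈ s, f i) = ∑ i ∈ s, reflect N (f i) := by
  ext k
  simp only [coeff_reflect, finsetSum_coeff]

theorem neg_one_pow_eq_C (k : ℕ) : ((-1 : ℤ[X]) ^ k) = C ((-1 : ℤ) ^ k) := by simp

open Classical in
theorem reflect_intervalPoly (M : Matroid α) (G : Set α) :
    reflect (setRk M G) (intervalPoly M ∅ G) =
      ∑ A : Set α with A ⊆ G, (-1) ^ A.ncard * X ^ setRk M A := by
  rw [intervalPoly, reflect_finset_sum]
  simp only [Set.empty_subset, true_and, Set.sdiff_empty]
  refine Finset.sum_congr rfl fun A hA => ?_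
  simp only [Finset.mem_filter, Finset.mem_univ, true_and] at hA
  have := setRk_mono M hA
  rw [neg_one_pow_eq_C, reflect_C_mul_X_pow, revAt_le (by omega)]
  congr 2
  omega

theorem natDegree_intervalPoly (M : Matroid α) (G : Set α) :
    (intervalPoly M ∅ G).natDegree ≤ setRk M G := by
  classical
  rw [intervalPoly]
  refine natDegree_sum_le_of_forall_le _ _ fun A _ => ?_
  rw [neg_one_pow_eq_C]
  exact (natDegree_C_mul_X_pow_le _ _).trans (Nat.sub_le _ _)

theorem intervalPoly_eq_zero (M : Matroid α) {F G : Set α} {e : α} (heG : e ∈ G) (heF : e ∉ F)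
    (he : e ∈ M.closure F) : intervalPoly M F G = 0 := by
  classical
  have hcl : ∀ A, F ⊆ A → setRk M (insert e A) = setRk M A := fun A hA => by
    have : M.closure (insert e A) = M.closure A :=
      Matroid.closure_insert_eq_of_mem_closure (M.closure_subset_closure hA he)
    rw [setRk, setRk, ← M.eRk_closure_eq (insert e A), this, M.eRk_closure_eq]
  have h0 := sum_toggle e (fun A => F ⊆ A ∧ A ⊆ G)
    (fun A => (X : ℤ[X]) ^ (setRk M G - setRk M A))
    (fun A _ => by
      simp only [Set.subset_insert_iff_of_notMem heF, Set.insert_subset_iff, heG, true_and])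
    (fun A _ hA => by simp only [hcl A hA.1])
  have h1 : (-1 : ℤ[X]) ^ F.ncard * intervalPoly M F G = 0 := by
    rw [← h0, intervalPoly, Finset.mul_sum]
    refine Finset.sum_congr (by ext; simp) fun A hA => ?_
    simp only [Finset.mem_filter, Finset.mem_univ, true_and] at hA
    rw [← Set.ncard_sdiff_add_ncard_of_subset hA.1, pow_add]
    ring
  rcases neg_one_pow_eq_or ℤ[X] F.ncard with h | h <;> rw [h] at h1 <;> simpa using h1

open Classical in
/-- The kernel property of the characteristic polynomials. -/
theorem kernel_identity (M : Matroid α) {G : Set α} (hG : M.IsFlat G) (hne : G.Nonempty) :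
    ∑ F ∈ flats M with F ⊆ G,
      reflect (setRk M F) (intervalPoly M ∅ F) * intervalPoly M F G = 0 := by
  have h1 : ∑ F ∈ flats M with F ⊆ G,
      reflect (setRk M F) (intervalPoly M ∅ F) * intervalPoly M F G =
      ∑ F : Set α with F ⊆ G,
        reflect (setRk M F) (intervalPoly M ∅ F) * intervalPoly M F G := by
    refine Finset.sum_subset (Finset.filter_subset_filter _ (Finset.subset_univ _)) ?_
    intro F hF hF'
    simp only [flats, Finset.mem_filter, Finset.mem_univ, true_and, not_and] at hF hF'
    have hnf : ¬ M.IsFlat F := fun h => hF' h hF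
    have hsub : ¬ M.closure F ⊆ F := fun h => hnf (Matroid.isFlat_iff_closure_eq.2
      (h.antisymm (M.subset_closure F (hF.trans hG.subset_ground))))
    obtain ⟨e, he, heF⟩ := Set.not_subset.1 hsub
    have heG : e ∈ G := hG.closure ▸ M.closure_subset_closure hF he
    rw [intervalPoly_eq_zero M heG heF he, mul_zero]
  rw [h1]
  simp only [reflect_intervalPoly]
  simp only [intervalPoly, Finset.sum_mul_sum]
  have h2 : ∀ F : Set α, F ⊆ G →
      ∑ A : Set α with A ⊆ F, ∑ B : Set α with F ⊆ B ∧ B ⊆ G,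
        ((-1 : ℤ[X]) ^ A.ncard * X ^ setRk M A) *
          ((-1) ^ (B \ F).ncard * X ^ (setRk M G - setRk M B)) =
      ∑ A : Set α, ∑ B : Set α, if A ⊆ F ∧ F ⊆ B ∧ B ⊆ G then
        (-1) ^ F.ncard * ((-1) ^ A.ncard * (-1) ^ B.ncard * X ^ setRk M A *
          X ^ (setRk M G - setRk M B)) else 0 := by
    intro F _
    rw [Finset.sum_filter]
    refine Finset.sum_congr rfl fun A _ => ?_
    by_cases hA : A ⊆ F
    · simp only [hA, true_and]
      rw [Finset.sum_filter]
      refine Finset.sum_congr rfl fun B _ => ?_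
      by_cases hB : F ⊆ B ∧ B ⊆ G
      · simp only [if_pos hB]
        rw [← Set.ncard_sdiff_add_ncard_of_subset hB.1, pow_add]
        have : (-1 : ℤ[X]) ^ F.ncard * (-1) ^ F.ncard = 1 := by
          rw [← mul_pow]; simp
        linear_combination (-(-1) ^ A.ncard * X ^ setRk M A * (-1) ^ (B \ F).ncard *
          X ^ (setRk M G - setRk M B)) * this
      · simp only [if_neg hB]
    · simp [hA]
  rw [Finset.sum_congr rfl fun F hF => h2 F (by simpa using hF), Finset.sum_comm]
  have h3 : ∀ A : Set α, ∑ F : Set α with F ⊆ G, ∑ B : Set α,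
      (if A ⊆ F ∧ F ⊆ B ∧ B ⊆ G then
        (-1 : ℤ[X]) ^ F.ncard * ((-1) ^ A.ncard * (-1) ^ B.ncard * X ^ setRk M A *
          X ^ (setRk M G - setRk M B)) else 0) =
      if A ⊆ G then (-1) ^ A.ncard * X ^ setRk M G else 0 := by
    intro A
    rw [Finset.sum_comm]
    rw [Finset.sum_eq_single A]
    · by_cases hA : A ⊆ G
      · rw [Finset.sum_eq_single A]
        · rw [if_pos ⟨subset_rfl, subset_rfl, hA⟩, if_pos hA]
          have h : (-1 : ℤ[X]) ^ A.ncard * (-1) ^ A.ncard = 1 := by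
            rw [← mul_pow]; simp
          have h' : (X : ℤ[X]) ^ setRk M A * X ^ (setRk M G - setRk M A) = X ^ setRk M G := by
            rw [← pow_add, Nat.add_sub_cancel' (setRk_mono M hA)]
          rw [← h']
          linear_combination ((-1) ^ A.ncard * X ^ setRk M A * X ^ (setRk M G - setRk M A)) * h
        · intro F _ hF
          rw [if_neg]
          exact fun h => hF (h.2.1.antisymm h.1)
        · intro h
          exact absurd (by simpa using hA) h
      · rw [if_neg hA]
        refine Finset.sum_eq_zero fun F _ => if_neg fun h => hA h.2.2
    · intro B _ hBA
      by_cases hAB : A ⊆ B ∧ B ⊆ G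
      · have hsub : ¬ B ⊆ A := fun h => hBA (h.antisymm hAB.1)
        obtain ⟨e, heB, heA⟩ := Set.not_subset.1 hsub
        have h0 := sum_toggle e (fun F => A ⊆ F ∧ F ⊆ B)
          (fun _ => ((-1 : ℤ[X]) ^ A.ncard * (-1) ^ B.ncard * X ^ setRk M A *
          X ^ (setRk M G - setRk M B)))
          (fun F _ => by
            simp only [Set.subset_insert_iff_of_notMem heA, Set.insert_subset_iff, heB, true_and])
          (fun _ _ _ => rfl)
        refine Eq.trans ?_ h0
        rw [Finset.sum_filter, Finset.sum_filter]
        refine Finset.sum_congr rfl fun F _ => ?_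
        by_cases hF : A ⊆ F ∧ F ⊆ B
        · rw [if_pos (hF.2.trans hAB.2), if_pos ⟨hF.1, hF.2, hAB.2⟩, if_pos hF]
        · rw [if_neg hF, if_neg (fun h : A ⊆ F ∧ F ⊆ B ∧ B ⊆ G => hF ⟨h.1, h.2.1⟩), ite_self]
      · refine Finset.sum_eq_zero fun F _ => if_neg fun h => hAB ⟨h.1.trans h.2.1, h.2.2⟩
    · intro h
      exact absurd (Finset.mem_univ _) h
  rw [Finset.sum_congr rfl fun A _ => h3 A, ← Finset.sum_filter]
  obtain ⟨e, he⟩ := hne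
  exact sum_toggle e (fun A => A ⊆ G) (fun _ => (X : ℤ[X]) ^ setRk M G)
    (fun A _ => by simp only [Set.insert_subset_iff, he, true_and]) (fun _ _ _ => rfl)

theorem coeff_lowPart (r : ℕ) (p : ℤ[X]) (i : ℕ) :
    (lowPart r p).coeff i = if 2 * i < r then p.coeff i else 0 := by
  rw [lowPart, finsetSum_coeff]
  simp only [coeff_monomial]
  rw [Finset.sum_ite_eq']
  simp only [Finset.mem_filter, Finset.mem_range]
  by_cases h : 2 * i < r
  · rw [if_pos ⟨by omega, h⟩, if_pos h]
  · rw [if_neg fun h' => h h'.2, if_neg h]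

theorem klPoly_rank_zero (M : Matroid α) (hM : M.Loopless) (h : rkNat M = 0) : klPoly M = 1 := by
  rw [klPoly, if_pos hM, if_pos h]

theorem klPoly_degree (M : Matroid α) (hM : M.Loopless) (h : 0 < rkNat M) :
    2 * (klPoly M).natDegree < rkNat M := by
  by_contra hlt
  by_cases h0 : klPoly M = 0
  · rw [h0, natDegree_zero] at hlt
    omega
  · have hc : (klPoly M).coeff (klPoly M).natDegree = 0 := by
      generalize (klPoly M).natDegree = d at hlt
      rw [klPoly, if_pos hM, if_neg (by omega), coeff_lowPart, if_neg hlt]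
    exact h0 (leadingCoeff_eq_zero.1 hc)

theorem natDegree_klPoly_le (M : Matroid α) : (klPoly M).natDegree ≤ rkNat M := by
  by_cases hM : M.Loopless
  · rcases Nat.eq_zero_or_pos (rkNat M) with h | h
    · rw [klPoly_rank_zero M hM h, natDegree_one]; omega
    · have := klPoly_degree M hM h; omega
  · rw [klPoly, if_neg hM, natDegree_zero]; omega

theorem isFlat_contract_iff (M : Matroid α) {F H : Set α} (hF : F ⊆ M.E) (hH : Disjoint H F) :
    (M ／ F).IsFlat H ↔ M.IsFlat (H ∪ F) := by
  rw [Matroid.isFlat_iff_closure_eq, Matroid.isFlat_iff_closure_eq, Matroid.contract_closure_eq]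
  constructor
  · intro h
    by_cases hHF : H ∪ F ⊆ M.E
    · have hs : F ⊆ M.closure (H ∪ F) := Set.subset_union_right.trans (M.subset_closure _ hHF)
      exact (Set.sdiff_union_of_subset hs).symm.trans (by rw [h])
    · exfalso
      refine hHF (Set.union_subset ?_ hF)
      rw [← h]
      exact Set.sdiff_subset.trans (M.closure_subset_ground _)
  · intro h
    rw [h, Set.union_sdiff_right, hH.sdiff_eq_left]

theorem contract_loopless (M : Matroid α) {F : Set α} (hF : M.IsFlat F) : (M ／ F).Loopless := by
  rw [Matroid.loopless_iff, Matroid.contract_loops_eq, hF.closure, Set.sdiff_self]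

open Classical in
theorem sum_flats_contract (M : Matroid α) {F : Set α} (hF : M.IsFlat F)
    (Q : Matroid α → ℤ[X]) :
    ∑ H ∈ flats (M ／ F), charPoly ((M ／ F) ↾ H) * Q ((M ／ F) ／ H) =
      ∑ G ∈ flats M with F ⊆ G, intervalPoly M F G * Q (M ／ G) := by
  have hdis : ∀ H ∈ flats (M ／ F), Disjoint H F := by
    intro H hH
    simp only [flats, Finset.mem_filter, Finset.mem_univ, true_and] at hH
    exact Set.disjoint_of_subset_left hH.subset_ground Set.disjoint_sdiff_left
  refine Finset.sum_nbij' (fun H => H ∪ F) (fun G => G \ F) ?_ ?_ ?_ ?_ ?_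
  · intro H hH
    have hd := hdis H hH
    simp only [flats, Finset.mem_filter, Finset.mem_univ, true_and] at hH ⊢
    exact ⟨(isFlat_contract_iff M hF.subset_ground hd).1 hH, Set.subset_union_right⟩
  · intro G hG
    simp only [flats, Finset.mem_filter, Finset.mem_univ, true_and] at hG ⊢
    rw [isFlat_contract_iff M hF.subset_ground Set.disjoint_sdiff_left,
      Set.sdiff_union_of_subset hG.2]
    exact hG.1
  · intro H hH
    rw [Set.union_sdiff_right, (hdis H hH).sdiff_eq_left]
  · intro G hG
    simp only [Finset.mem_filter] at hG
    exact Set.sdiff_union_of_subset hG.2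
  · intro H hH
    have hd := hdis H hH
    rw [← charPoly_minor M Set.subset_union_right, Set.union_sdiff_right, hd.sdiff_eq_left,
      Matroid.contract_contract, Set.union_comm F H]

theorem setRk_empty (M : Matroid α) : setRk M ∅ = 0 := by simp [setRk]

theorem intervalPoly_self (M : Matroid α) : intervalPoly M ∅ ∅ = 1 := by
  classical
  rw [intervalPoly, Finset.sum_eq_single ∅]
  · simp
  · intro A hA hne
    simp only [Finset.mem_filter, Finset.mem_univ, true_and] at hA
    exact absurd (Set.subset_empty_iff.1 hA.2) hne
  · intro h
    simp at h

theorem isFlat_empty (M : Matroid α) (hM : M.Loopless) : M.IsFlat ∅ :=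
  Matroid.isFlat_iff_closure_eq.2 hM.loops_eq_empty

theorem rkNat_contract_add (M : Matroid α) {F : Set α} (hF : F ⊆ M.E) :
    rkNat (M ／ F) + setRk M F = rkNat M := by
  rw [rkNat_eq, rkNat_eq, Matroid.contract_ground, setRk_contract M Set.disjoint_sdiff_left,
    Set.sdiff_union_of_subset hF]

open Classical in
theorem sum_flats_split (M : Matroid α) (hM : M.Loopless) (Q : Matroid α → ℤ[X]) :
    ∑ F ∈ flats M, charPoly (M ↾ F) * Q (M ／ F) =
      Q M + ∑ F ∈ flats M with F.Nonempty, charPoly (M ↾ F) * Q (M ／ F) := by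
  rw [← Finset.sum_filter_not_add_sum_filter (flats M) (fun F => F.Nonempty)]
  congr 1
  rw [Finset.sum_eq_single ∅]
  · rw [charPoly_restrict, intervalPoly_self, Matroid.contract_empty, one_mul]
  · intro F hF hne
    simp only [Finset.mem_filter, Set.not_nonempty_iff_eq_empty] at hF
    exact absurd hF.2 hne
  · intro h
    exact absurd (by simp [flats, isFlat_empty M hM]) h

/-- `t^(rk M) P_M(1/t) = ∑_F χ_{M|F}(t) P_{M/F}(t)`. -/
theorem klPoly_reflect (M : Matroid α) (hM : M.Loopless) :
    reflect (rkNat M) (klPoly M) = ∑ F ∈ flats M, charPoly (M ↾ F) * klPoly (M ／ F) := by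
  classical
  induction hn : M.E.toFinset.card using Nat.strong_induction_on generalizing M with
  | _ n ih =>
  subst hn
  rcases Nat.eq_zero_or_pos (rkNat M) with h0 | hpos
  · have hE : M.E = ∅ := by
      by_contra hne
      obtain ⟨e, he⟩ := Set.nonempty_iff_ne_empty.2 hne
      have h1 := Matroid.eRk_singleton_eq (M := M) (e := e) he
      have h2 := setRk_mono M (Set.singleton_subset_iff.2 he)
      rw [← rkNat_eq, h0, setRk, h1] at h2
      simp at h2
    rw [sum_flats_split M hM, klPoly_rank_zero M hM h0, h0, Finset.sum_eq_zero]
    · simp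
    · intro F hF
      simp only [flats, Finset.mem_filter, Finset.mem_univ, true_and] at hF
      obtain ⟨x, hx⟩ := hF.2
      have := hF.1.subset_ground hx
      rw [hE] at this
      exact absurd this (Set.notMem_empty x)
  · set S : ℤ[X] := ∑ F ∈ flats M with F.Nonempty, charPoly (M ↾ F) * klPoly (M ／ F) with hS
    have hP : klPoly M = lowPart (rkNat M) (-S) := by
      rw [klPoly, if_pos hM, if_neg hpos.ne', hS]
      congr 2
      rw [flats, Finset.filter_filter,
        ← Finset.sum_subtype_eq_sum_filter (s := Finset.univ)]
      simp only [Finset.subtype_univ]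
    have hanti : reflect (rkNat M) S = -S := by
      have key : reflect (rkNat M) S =
          ∑ F ∈ flats M with F.Nonempty, ∑ G ∈ flats M with F ⊆ G,
            reflect (setRk M F) (intervalPoly M ∅ F) * (intervalPoly M F G * klPoly (M ／ G)) := by
        rw [hS, reflect_finset_sum]
        refine Finset.sum_congr rfl fun F hF => ?_
        simp only [flats, Finset.mem_filter, Finset.mem_univ, true_and] at hF
        have hr := rkNat_contract_add M hF.1.subset_ground
        rw [← hr, add_comm (rkNat (M ／ F)), charPoly_restrict,
          reflect_mul _ _ (natDegree_intervalPoly M F) (natDegree_klPoly_le _),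
          ih _ (contract_card_lt M hF.1 hF.2) _ (contract_loopless M hF.1) rfl,
          sum_flats_contract M hF.1, Finset.mul_sum]
      have hswap : reflect (rkNat M) S =
          ∑ G ∈ flats M with G.Nonempty, (∑ F ∈ flats M with F.Nonempty ∧ F ⊆ G,
            reflect (setRk M F) (intervalPoly M ∅ F) * intervalPoly M F G) * klPoly (M ／ G) := by
        rw [key]
        simp only [Finset.sum_mul]
        rw [Finset.sum_comm' (t' := (flats M).filter fun G => G.Nonempty)
          (s' := fun G => (flats M).filter fun F => F.Nonempty ∧ F ⊆ G)]
        · simp only [mul_assoc]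
        · intro F G
          simp only [Finset.mem_filter]
          constructor
          · rintro ⟨⟨h1, h2⟩, h3, h4⟩
            exact ⟨⟨h1, h2, h4⟩, h3, h2.mono h4⟩
          · rintro ⟨⟨h1, h2, h4⟩, h3, _⟩
            exact ⟨⟨h1, h2⟩, h3, h4⟩
      rw [hswap, hS, ← Finset.sum_neg_distrib]
      refine Finset.sum_congr rfl fun G hG => ?_
      simp only [flats, Finset.mem_filter, Finset.mem_univ, true_and] at hG
      have hk := kernel_identity M hG.1 hG.2
      rw [← Finset.sum_filter_not_add_sum_filter _ (fun F => F.Nonempty), Finset.filter_filter,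
        Finset.filter_filter, Finset.sum_eq_single ∅] at hk
      · rw [setRk_empty, intervalPoly_self, reflect_one, pow_zero, one_mul] at hk
        rw [charPoly_restrict, ← neg_mul]
        congr 1
        rw [eq_neg_iff_add_eq_zero, add_comm, ← hk]
        simp only [and_comm]
      · intro F hF hne
        simp only [Finset.mem_filter, Set.not_nonempty_iff_eq_empty] at hF
        exact absurd hF.2.2 hne
      · intro h
        exact absurd (by simp [flats, isFlat_empty M hM]) h
    rw [sum_flats_split M hM, ← hS]
    have hdeg : S.natDegree ≤ rkNat M := by
      rw [hS]
      refine natDegree_sum_le_of_forall_le _ _ fun F hF => ?_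
      simp only [flats, Finset.mem_filter, Finset.mem_univ, true_and] at hF
      rw [charPoly_restrict, ← rkNat_contract_add M hF.1.subset_ground, add_comm]
      exact natDegree_mul_le.trans
        (add_le_add (natDegree_intervalPoly M F) (natDegree_klPoly_le _))
    ext i
    have hc : ∀ j, j ≤ rkNat M → S.coeff (rkNat M - j) = -S.coeff j := fun j hj => by
      have := congrArg (fun p => coeff p j) hanti
      simpa only [coeff_reflect, revAt_le hj, coeff_neg] using this
    rw [coeff_reflect, coeff_add, hP, coeff_lowPart, coeff_lowPart, coeff_neg, coeff_neg]
    by_cases hi : i ≤ rkNat M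
    · rw [revAt_le hi]
      have hci := hc i hi
      rcases lt_trichotomy (2 * i) (rkNat M) with h | h | h
      · rw [if_neg (by omega), if_pos h]; ring
      · rw [if_neg (by omega), if_neg (by omega)]
        rw [show rkNat M - i = i by omega] at hci
        omega
      · rw [if_pos (by omega), if_neg (by omega), hci]; ring
    · rw [revAt_eq_self_of_lt (by omega), if_neg (by omega),
        coeff_eq_zero_of_natDegree_lt (by omega), add_zero]

/-- The three properties above determine the Kazhdan–Lusztig polynomials. -/
theorem klPoly_unique (Q : Matroid α → ℤ[X])
    (h0 : ∀ M : Matroid α, M.Loopless → rkNat M = 0 → Q M = 1)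
    (hdeg : ∀ M : Matroid α, M.Loopless → 0 < rkNat M → 2 * (Q M).natDegree < rkNat M)
    (hQ : ∀ M : Matroid α, M.Loopless →
      reflect (rkNat M) (Q M) = ∑ F ∈ flats M, charPoly (M ↾ F) * Q (M ／ F))
    (M : Matroid α) (hM : M.Loopless) : Q M = klPoly M := by
  classical
  induction hn : M.E.toFinset.card using Nat.strong_induction_on generalizing M with
  | _ n ih =>
  subst hn
  rcases Nat.eq_zero_or_pos (rkNat M) with hr | hpos
  · rw [h0 M hM hr, klPoly_rank_zero M hM hr]
  · have h1 := hQ M hM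
    have h2 := klPoly_reflect M hM
    rw [sum_flats_split M hM] at h1 h2
    have hsum : ∑ F ∈ flats M with F.Nonempty, charPoly (M ↾ F) * Q (M ／ F) =
        ∑ F ∈ flats M with F.Nonempty, charPoly (M ↾ F) * klPoly (M ／ F) := by
      refine Finset.sum_congr rfl fun F hF => ?_
      simp only [flats, Finset.mem_filter, Finset.mem_univ, true_and] at hF
      rw [ih _ (contract_card_lt M hF.1 hF.2) _ (contract_loopless M hF.1) rfl]
    rw [hsum] at h1
    have h3 : reflect (rkNat M) (Q M - klPoly M) = Q M - klPoly M := by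
      rw [reflect_sub, h1, h2]; ring
    have hq := hdeg M hM hpos
    have hk := klPoly_degree M hM hpos
    have hz : ∀ i, rkNat M ≤ 2 * i → (Q M - klPoly M).coeff i = 0 := fun i hi => by
      rw [coeff_sub, coeff_eq_zero_of_natDegree_lt (by omega),
        coeff_eq_zero_of_natDegree_lt (by omega), sub_zero]
    rw [← sub_eq_zero]
    ext i
    rw [coeff_zero]
    by_cases hi : rkNat M ≤ 2 * i
    · exact hz i hi
    · rw [← h3, coeff_reflect, revAt_le (by omega)]
      exact hz _ (by omega)

end KazhdanLusztigSpec

/-! ### Uniform and Catalan matroids -/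

/-- The uniform matroid of rank `k` on `N` elements: its bases are the sets of size `k`. -/
def uniformMatroid (k N : ℕ) (hk : k ≤ N) : Matroid (Fin N) :=
  Matroid.ofIsBaseOfFinite (E := Set.univ) Set.finite_univ (fun B => B.ncard = k)
    (by
      obtain ⟨T, -, hT⟩ := Finset.exists_subset_card_eq
        (s := (Finset.univ : Finset (Fin N))) (n := k) (by simpa using hk)
      exact ⟨T, by simpa using hT⟩)
    (by
      intro A B hA hB e he
      have hlt : (A \ {e}).ncard < B.ncard := by
        rw [hB, ← hA]
        exact Set.ncard_lt_ncard (Set.sdiff_singleton_ssubset.2 he.1)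
      obtain ⟨f, hfB, hf⟩ := Set.exists_mem_notMem_of_ncard_lt_ncard hlt
      have hfe : f ≠ e := fun h => he.2 (h ▸ hfB)
      refine ⟨f, ⟨hfB, fun h => hf ⟨h, hfe⟩⟩, ?_⟩
      change (insert f (A \ {e})).ncard = k
      rw [Set.ncard_insert_of_notMem hf, Set.ncard_sdiff_singleton_add_one he.1, hA])
    (fun _ _ => Set.subset_univ _)

/-- The componentwise order on subsets of equal size: the `i`-th smallest element of `T` is at most
the `i`-th smallest element of `S`, for every `i`. -/
def GaleLE {N : ℕ} (T S : Finset (Fin N)) : Prop :=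
  ∃ h : T.card = S.card, ∀ i : Fin S.card, T.orderEmbOfFin h i ≤ S.orderEmbOfFin rfl i

theorem galeLE_iff {N : ℕ} (T S : Finset (Fin N)) :
    GaleLE T S ↔ T.card = S.card ∧
      ∀ x, (S.filter (· ≤ x)).card ≤ (T.filter (· ≤ x)).card := by
  constructor
  · rintro ⟨h, hle⟩
    refine ⟨h, fun x => ?_⟩
    have key : ∀ U : Finset (Fin N), ∀ hU : U.card = S.card,
        U.filter (· ≤ x) =
          (Finset.univ.filter fun i : Fin S.card => U.orderEmbOfFin hU i ≤ x).map
            (U.orderEmbOfFin hU).toEmbedding := by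
      intro U hU
      ext y
      simp only [Finset.mem_filter, Finset.mem_map, Finset.mem_univ, true_and,
        RelEmbedding.coe_toEmbedding]
      constructor
      · rintro ⟨hy, hyx⟩
        have : y ∈ Set.range (U.orderEmbOfFin hU) := by
          rw [Finset.range_orderEmbOfFin]; exact hy
        obtain ⟨i, rfl⟩ := this
        exact ⟨i, hyx, rfl⟩
      · rintro ⟨i, hi, rfl⟩
        exact ⟨Finset.orderEmbOfFin_mem _ _ _, hi⟩
    rw [key S rfl, key T h, Finset.card_map, Finset.card_map]
    refine Finset.card_le_card fun i hi => ?_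
    simp only [Finset.mem_filter, Finset.mem_univ, true_and] at hi ⊢
    exact (hle i).trans hi
  · rintro ⟨h, hle⟩
    refine ⟨h, fun i => ?_⟩
    by_contra hlt
    rw [not_le] at hlt
    have h1 : (i : ℕ) + 1 ≤ (S.filter (· ≤ S.orderEmbOfFin rfl i)).card := by
      have : (Finset.Iic i).map (S.orderEmbOfFin rfl).toEmbedding ⊆
          S.filter (· ≤ S.orderEmbOfFin rfl i) := by
        intro y hy
        simp only [Finset.mem_map, Finset.mem_Iic, RelEmbedding.coe_toEmbedding] at hy
        obtain ⟨j, hj, rfl⟩ := hy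
        simp only [Finset.mem_filter]
        exact ⟨Finset.orderEmbOfFin_mem _ _ _, (S.orderEmbOfFin rfl).monotone hj⟩
      simpa using Finset.card_le_card this
    have h2 : (T.filter (· ≤ S.orderEmbOfFin rfl i)).card ≤ i := by
      have : T.filter (· ≤ S.orderEmbOfFin rfl i) ⊆
          (Finset.Iio i).map (T.orderEmbOfFin h).toEmbedding := by
        intro y hy
        simp only [Finset.mem_filter] at hy
        have hr : y ∈ Set.range (T.orderEmbOfFin h) := by
          rw [Finset.range_orderEmbOfFin]; exact hy.1
        obtain ⟨j, rfl⟩ := hr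
        simp only [Finset.mem_map, Finset.mem_Iio, RelEmbedding.coe_toEmbedding]
        exact ⟨j, (T.orderEmbOfFin h).lt_iff_lt.1 (hy.2.trans_lt hlt), rfl⟩
      simpa using Finset.card_le_card this
    have := hle (S.orderEmbOfFin rfl i)
    omega

/-- The Schubert matroid on `Fin N` given by `S`: its bases are the sets `T ≤ S` in the
componentwise order. -/
def schubertMatroid {N : ℕ} (S : Finset (Fin N)) : Matroid (Fin N) :=
  Matroid.ofIsBaseOfFinite (E := Set.univ) Set.finite_univ
    (fun B => ∃ T : Finset (Fin N), (T : Set (Fin N)) = B ∧ GaleLE T S)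
    ⟨S, S, rfl, rfl, fun _ => le_rfl⟩
    (by
      rintro _ _ ⟨T, rfl, hT⟩ ⟨U, rfl, hU⟩ e ⟨heT, heU⟩
      rw [Finset.mem_coe] at heT heU
      rw [galeLE_iff] at hT hU
      obtain ⟨hTc, hT⟩ := hT
      obtain ⟨hUc, hU⟩ := hU
      have hne : (U \ T).Nonempty := by
        rw [Finset.sdiff_nonempty]
        intro hsub
        exact heU ((Finset.eq_of_subset_of_card_le hsub (by omega)).symm ▸ heT)
      set f := (U \ T).min' hne with hf
      have hfm : f ∈ U \ T := Finset.min'_mem _ _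
      have hfU : f ∈ U := (Finset.mem_sdiff.1 hfm).1
      have hfT : f ∉ T := (Finset.mem_sdiff.1 hfm).2
      have hfe : f ≠ e := fun h => heU (h ▸ hfU)
      have hmin : ∀ y ∈ U, y ∉ T → f ≤ y := fun y hy hy' =>
        Finset.min'_le _ _ (Finset.mem_sdiff.2 ⟨hy, hy'⟩)
      refine ⟨f, ⟨hfU, hfT⟩, insert f (T.erase e), by simp, ?_⟩
      have hfT' : f ∉ T.erase e := fun h => hfT (Finset.mem_of_mem_erase h)
      rw [galeLE_iff]
      refine ⟨?_, fun x => ?_⟩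
      · rw [Finset.card_insert_of_notMem hfT', Finset.card_erase_add_one heT, hTc]
      · by_cases hfx : f ≤ x
        · refine (hT x).trans ?_
          rw [Finset.filter_insert, if_pos hfx, Finset.card_insert_of_notMem (by simp [hfT]),
            Finset.filter_erase]
          have := Finset.pred_card_le_card_erase (s := T.filter (· ≤ x)) (a := e)
          omega
        · refine (hU x).trans (Finset.card_le_card fun y hy => ?_)
          rw [Finset.mem_filter] at hy ⊢
          refine ⟨Finset.mem_insert_of_mem (Finset.mem_erase.2 ⟨?_, ?_⟩), hy.2⟩
          · rintro rfl; exact heU hy.1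
          · by_contra hyT
            exact hfx ((hmin y hy.1 hyT).trans hy.2))
    (fun _ _ => Set.subset_univ _)

/-- The uniform matroid `U_n^{a,b}` of rank `n b` on `n (a + b)` elements. -/
def uniformAB (n a b : ℕ) : Matroid (Fin (n * (a + b))) :=
  uniformMatroid (n * b) (n * (a + b)) (Nat.mul_le_mul_left n (Nat.le_add_left b a))

/-- The subset of `Fin (n (a + b))` whose indicator vector is `(0^a, 1^b, …, 0^a, 1^b)`,
with `n` blocks `0^a, 1^b`. -/
def catalanSet (n a b : ℕ) : Finset (Fin (n * (a + b))) :=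
  Finset.univ.filter fun i => a ≤ (i : ℕ) % (a + b)

/-- The `(a,b)`-Catalan matroid `C_n^{a,b}`. -/
def catalanMatroid (n a b : ℕ) : Matroid (Fin (n * (a + b))) :=
  schubertMatroid (catalanSet n a b)

/-- The direct sum `U_λ^{a,b}` of the matroids `U_{λ_i}^{a,b}` over the parts `λ_i` of `λ`
(with multiplicity). -/
def uniformSum {n : ℕ} (a b : ℕ) (lam : n.Partition) :
    Matroid ((i : lam.parts.ToType) × Fin ((i : ℕ) * (a + b))) :=
  Matroid.sigma fun i : lam.parts.ToType => uniformAB (i : ℕ) a b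

/-- `z_λ = ∏_{i=1}^n i^{α_i} α_i!`, with `α_i` the number of parts of `λ` equal to `i`. -/
def zFactor {n : ℕ} (lam : n.Partition) : ℕ :=
  ∏ i ∈ Finset.Icc 1 n, i ^ lam.parts.count i * (lam.parts.count i).factorial

/-! The right-hand side is the complete homogeneous function `h_n` written in power sums `p_i =
Z(U_i)`, so the claim is equivalent to n! Z(C_n) = ∑ over permutations of [n] of ∏ over cycles of
Z(U_length). Grouping permutations by their cycle supports gives a sum over set partitions P of [n],
with weight ∏ (|Y| - 1)! (`factorial_mul_zPoly_catalanMatroid`); the return to integer partitions is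
Newton's identity (`sumOverPartitions_succ`) with the exponential formula
(`sum_cycleWeight_mul_prod`).

Work on n blocks of size a + b. An ordering L of the blocks gives a copy of C_n, in which I is
independent iff every prefix T of L satisfies |I ∩ T| ≤ b|T|; a set partition P gives the direct sum
of the uniform matroids of rank b|Y| on its parts. The identity is obtained from two facts.

Valuativity (`sum_zeta_eq_zero`). Unfolding the Kazhdan–Lusztig recursion writes each coefficient of
Z as a sum, over chains of sets, of functions of the ranks along the chain. A linear relation
between rank functions that is seen by every test function on every chain therefore passes to Z. For
this the recursion is stated over all sets, with value 0 at non-flats, so that it involves the rank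
function alone.

The relation (`sum_orderings_eq_sum_setPartitions`). Extend a chain to a total order of the
elements. The ranks along the chain are r(A) = |A ∩ B|, with B the greedy basis for that order, so
it is enough to show that each B is the greedy basis of equally many orderings and weighted
partitions. Give a block the weight |B ∩ block| - b. B is greedy for L when all prefix weights are
at most 0, the total is 0, and every block lies in a prefix of weight 0 whose B-elements all come
before the non-B elements of that block (`IsAdmissible`). B is greedy for P when each part has
weight 0 and its B-elements come before all its non-B elements (`IsBalanced`). Let x be a block
containing the earliest non-B element. The shortest weight-0 prefix of L containing x is an ordering
of a balanced set Y, and the rest of L is again admissible. By the cycle lemma exactly (|Y| - 1)!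
orderings of Y arise in this way (`card_isFirstReturn`), which is the recursion for weighted
partitions by the part containing x (`card_isAdmissible`).

Multiplicativity of Z over direct sums holds because the products of the Kazhdan–Lusztig polynomials
of the summands satisfy the defining recursion of the sum (`IsKL.sigma`). -/

/-! ### Kazhdan–Lusztig families of rank functions -/

section RankFunctions

set_option linter.unusedSectionVars false

variable {α : Type*} [Fintype α]

open Classical in
/-- The characteristic polynomial of the interval from `A` to `B`, for a rank function `r`. -/
noncomputable def rankInterval (r : Set α → ℕ) (A B : Set α) : ℤ[X] :=
  ∑ C : Set α with A ⊆ C ∧ C ⊆ B, (-1) ^ (C \ A).ncard * X ^ (r B - r C)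

open Classical in
/-- `p` assigns to each set `A` the Kazhdan–Lusztig polynomial of the contraction by `A`, expressed
through the rank function `r` only; non-flats are assigned `0`. -/
structure IsKL (r : Set α → ℕ) (p : Set α → ℤ[X]) : Prop where
  mono : Monotone r
  univ : p Set.univ = 1
  deg : ∀ A, A ≠ Set.univ → p A = 0 ∨ 2 * (p A).natDegree < r Set.univ - r A
  refl : ∀ A, reflect (r Set.univ - r A) (p A) = ∑ B with A ⊆ B, rankInterval r A B * p B

open Classical in
/-- The `Z`-polynomial attached to a rank function and a Kazhdan–Lusztig family. -/
noncomputable def zeta (r : Set α → ℕ) (p : Set α → ℤ[X]) : ℤ[X] :=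
  ∑ A : Set α, X ^ r A * p A

theorem rankInterval_self (r : Set α → ℕ) (A : Set α) : rankInterval r A A = 1 := by
  classical
  rw [rankInterval, Finset.sum_eq_single A]
  · simp
  · intro C hC hne
    simp only [Finset.mem_filter, Finset.mem_univ, true_and] at hC
    exact absurd (hC.2.antisymm hC.1) hne
  · intro h
    exact absurd (Finset.mem_filter.2 ⟨Finset.mem_univ _, subset_rfl, subset_rfl⟩) h

-- The reflection moves a coefficient of degree below half the corank to one above half, which is
-- zero; the term `B = A` of the reflection identity is `p A` itself, so the remaining terms
-- determine it. This is the form of the recursion that involves only larger sets.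
open Classical in
theorem IsKL.coeff_eq {r : Set α → ℕ} {p : Set α → ℤ[X]} (h : IsKL r p) {A : Set α}
    (hA : A ≠ Set.univ) (i : ℕ) :
    (p A).coeff i = if 2 * i < r Set.univ - r A then
      -∑ B with A ⊂ B, (rankInterval r A B * p B).coeff i else 0 := by
  have hhigh : ∀ j, r Set.univ - r A ≤ 2 * j → (p A).coeff j = 0 := by
    intro j hj
    rcases h.deg A hA with h0 | h0
    · rw [h0, coeff_zero]
    · exact coeff_eq_zero_of_natDegree_lt (by omega)
  split_ifs with hi
  · have h1 := congrArg (fun q => coeff q i) (h.refl A)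
    have hs : (Finset.univ.filter fun B : Set α => A ⊆ B) =
        insert A (Finset.univ.filter fun B : Set α => A ⊂ B) := by
      ext B
      simp only [Finset.mem_filter, Finset.mem_univ, true_and, Finset.mem_insert]
      constructor
      · intro hB
        rcases hB.eq_or_ssubset with h2 | h2
        · exact Or.inl h2.symm
        · exact Or.inr h2
      · rintro (rfl | hB)
        · exact subset_rfl
        · exact hB.subset
    rw [coeff_reflect, revAt_le (by omega), hhigh _ (by omega), hs,
      Finset.sum_insert (by simp), rankInterval_self, one_mul, coeff_add, finsetSum_coeff] at h1
    linarith
  · exact hhigh i (by omega)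

theorem IsKL.unique {r : Set α → ℕ} {p q : Set α → ℤ[X]} (hp : IsKL r p) (hq : IsKL r q) :
    p = q := by
  classical
  have key : ∀ n, ∀ A : Set α, Aᶜ.ncard = n → p A = q A := by
    intro n
    induction n using Nat.strong_induction_on with
    | _ n ih =>
    intro A hn
    by_cases hA : A = Set.univ
    · rw [hA, hp.univ, hq.univ]
    · ext i
      rw [hp.coeff_eq hA, hq.coeff_eq hA]
      congr 2
      refine Finset.sum_congr rfl fun B hB => ?_
      simp only [Finset.mem_filter, Finset.mem_univ, true_and] at hB
      rw [ih _ _ B rfl]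
      rw [← hn]
      exact Set.ncard_lt_ncard (compl_lt_compl_iff_lt.2 hB)
  exact funext fun A => key _ A rfl

theorem klPoly_of_not_loopless (M : Matroid α) (h : ¬ M.Loopless) : klPoly M = 0 := by
  rw [klPoly, if_neg h]

theorem klPoly_contract_of_not_isFlat (M : Matroid α) (hM : M.E = Set.univ) {A : Set α}
    (hA : ¬ M.IsFlat A) : klPoly (M ／ A) = 0 := by
  apply klPoly_of_not_loopless
  rw [Matroid.loopless_iff, Matroid.contract_loops_eq, Set.sdiff_eq_empty]
  intro h
  exact hA (Matroid.isFlat_iff_closure_eq.2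
    (h.antisymm (M.subset_closure A (hM ▸ Set.subset_univ A))))

/-- Passing from flats to all sets costs nothing: contracting a non-flat creates a loop, so the
value there is 0, and for a non-flat `A` the right-hand side vanishes too, since the interval
polynomial from `A` to a flat is zero by toggling an element of the closure of `A`. -/
theorem isKL_matroid (M : Matroid α) (hM : M.E = Set.univ) :
    IsKL (setRk M) fun A => klPoly (M ／ A) := by
  classical
  have hr : ∀ A, rkNat (M ／ A) = setRk M Set.univ - setRk M A := fun A => by
    have h := rkNat_contract_add M (hM ▸ Set.subset_univ A : A ⊆ M.E)
    rw [rkNat_eq M, hM] at h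
    omega
  have hflats : ∀ A : Set α, ∑ B with A ⊆ B, rankInterval (setRk M) A B * klPoly (M ／ B) =
      ∑ B ∈ flats M with A ⊆ B, intervalPoly M A B * klPoly (M ／ B) := by
    intro A
    symm
    refine Finset.sum_subset (Finset.filter_subset_filter _ (Finset.subset_univ _)) ?_
    intro B hB hB'
    simp only [flats, Finset.mem_filter, Finset.mem_univ, true_and, not_and] at hB hB'
    rw [klPoly_contract_of_not_isFlat M hM (fun h => hB' h hB), mul_zero]
  refine ⟨fun A B h => setRk_mono M h, ?_, ?_, ?_⟩
  · have hE : (M ／ (Set.univ : Set α)).E = ∅ := by simp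
    refine klPoly_rank_zero _ ?_ ?_
    · exact (Matroid.loopless_iff _).2 (Set.subset_empty_iff.1 (hE ▸ Matroid.loops_subset_ground _))
    · rw [hr]; omega
  · intro A hA
    by_cases hl : (M ／ A).Loopless
    · right
      rcases Nat.eq_zero_or_pos (rkNat (M ／ A)) with h0 | h0
      · exfalso
        obtain ⟨e, he⟩ := (Set.ne_univ_iff_exists_notMem A).1 hA
        have he' : e ∈ (M ／ A).E := ⟨hM ▸ Set.mem_univ e, he⟩
        have h1 := Matroid.eRk_singleton_eq (M := M ／ A) (e := e) he'
        have h2 := setRk_mono (M ／ A) (Set.singleton_subset_iff.2 he')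
        rw [← rkNat_eq, h0, setRk, h1] at h2
        simp at h2
      · rw [← hr]
        exact klPoly_degree _ hl h0
    · exact Or.inl (klPoly_of_not_loopless _ hl)
  · intro A
    rw [hflats]
    by_cases hA : M.IsFlat A
    · rw [← hr, klPoly_reflect _ (contract_loopless M hA), sum_flats_contract M hA]
    · rw [klPoly_contract_of_not_isFlat M hM hA, reflect_zero]
      symm
      refine Finset.sum_eq_zero fun B hB => ?_
      simp only [flats, Finset.mem_filter, Finset.mem_univ, true_and] at hB
      have hsub : ¬ M.closure A ⊆ A := fun h => hA (Matroid.isFlat_iff_closure_eq.2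
        (h.antisymm (M.subset_closure A (hM ▸ Set.subset_univ A))))
      obtain ⟨e, he, heA⟩ := Set.not_subset.1 hsub
      rw [intervalPoly_eq_zero M (hB.1.closure ▸ M.closure_subset_closure hB.2 he) heA he,
        zero_mul]

theorem zPoly_eq_zeta (M : Matroid α) (hM : M.E = Set.univ) :
    zPoly M = zeta (setRk M) fun A => klPoly (M ／ A) := by
  classical
  rw [zPoly, zeta]
  refine (Finset.sum_congr rfl fun F _ => ?_).trans
    (Finset.sum_subset (Finset.subset_univ _) fun F _ hF => ?_)
  · rw [rkNat_eq, Matroid.restrict_ground_eq, setRk_restrict _ subset_rfl]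
  · rw [klPoly_contract_of_not_isFlat M hM (by simpa [flats] using hF), mul_zero]

theorem zPoly_eq_zeta_of_isKL (M : Matroid α) (hM : M.E = Set.univ) {p : Set α → ℤ[X]}
    (hp : IsKL (setRk M) p) : zPoly M = zeta (setRk M) p := by
  rw [zPoly_eq_zeta M hM, (isKL_matroid M hM).unique hp]

/-! ### Transport along bijections. -/

variable {β : Type*} [Fintype β]

theorem sum_sets_image {R : Type*} [AddCommMonoid R] (e : α ≃ β) (P : Set β → Prop)
    [DecidablePred P] [DecidablePred fun C : Set α => P (e '' C)] (f : Set β → R) :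
    ∑ C : Set α with P (e '' C), f (e '' C) = ∑ C : Set β with P C, f C := by
  refine Finset.sum_nbij' (fun C => e '' C) (fun C => e.symm '' C) ?_ ?_ ?_ ?_ ?_
  · intro C hC; simpa using hC
  · intro C hC; simpa [Set.image_image] using hC
  · intro C _; simp
  · intro C _; simp
  · intro C _; rfl

theorem IsKL.comp_equiv {r : Set β → ℕ} {p : Set β → ℤ[X]} (h : IsKL r p) (e : α ≃ β) :
    IsKL (fun A => r (e '' A)) (fun A => p (e '' A)) := by
  classical
  have hu : e '' (Set.univ : Set α) = Set.univ := by simp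
  have hI : ∀ A B : Set α, rankInterval (fun A => r (e '' A)) A B =
      rankInterval r (e '' A) (e '' B) := by
    intro A B
    rw [rankInterval, rankInterval,
      ← sum_sets_image e (fun C => e '' A ⊆ C ∧ C ⊆ e '' B) fun C => (-1) ^ (C \ e '' A).ncard * X ^ (r (e '' B) - r C)]
    refine Finset.sum_congr ?_ fun C _ => ?_
    · ext C; simp
    · rw [← Set.image_sdiff e.injective, Set.ncard_image_of_injective _ e.injective]
  refine ⟨fun A B hAB => h.mono (Set.image_mono hAB), ?_, ?_, ?_⟩
  · simp only [hu, h.univ]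
  · intro A hA
    simp only [hu]
    refine h.deg _ fun h' => hA ?_
    rw [← hu] at h'
    exact e.injective.image_injective h'
  · intro A
    simp only [hu]
    rw [h.refl, ← sum_sets_image e (fun C => e '' A ⊆ C) fun C => rankInterval r (e '' A) C * p C]
    refine Finset.sum_congr ?_ fun C _ => ?_
    · ext C; simp
    · rw [hI]

theorem zeta_comp_equiv (r : Set β → ℕ) (p : Set β → ℤ[X]) (e : α ≃ β) :
    zeta (fun A => r (e '' A)) (fun A => p (e '' A)) = zeta r p := by
  classical
  have := sum_sets_image e (fun _ => True) fun C => X ^ r C * p C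
  simpa [zeta] using this

/-! ### Direct sums. -/

variable {ι : Type*} [Fintype ι] {γ : ι → Type*} [∀ i, Fintype (γ i)]

theorem sum_sets_sigma {R : Type*} [CommRing R] (P : ∀ i, Set (γ i) → Prop)
    [∀ i, DecidablePred (P i)]
    [DecidablePred fun C : Set ((i : ι) × γ i) => ∀ i, P i (Sigma.mk i ⁻¹' C)]
    (f : ∀ i, Set (γ i) → R) :
    ∑ C : Set ((i : ι) × γ i) with ∀ i, P i (Sigma.mk i ⁻¹' C), ∏ i, f i (Sigma.mk i ⁻¹' C) =
      ∏ i, ∑ C : Set (γ i) with P i C, f i C := by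
  classical
  rw [Finset.prod_univ_sum]
  refine Finset.sum_nbij' (fun C i => Sigma.mk i ⁻¹' C) (fun c => Set.univ.sigma c) ?_ ?_ ?_ ?_ ?_
  · intro C hC
    simpa using hC
  · intro c hc
    simpa using hc
  · intro C _
    exact Set.univ_sigma_preimage_mk C
  · intro c _
    funext i
    simp
  · intro C _
    rfl

theorem sigma_subset_iff_fibers {A B : Set ((i : ι) × γ i)} :
    A ⊆ B ↔ ∀ i, Sigma.mk i ⁻¹' A ⊆ Sigma.mk i ⁻¹' B :=
  ⟨fun h _ _ hx => h hx, fun h ⟨i, _⟩ hx => h i hx⟩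

theorem ncard_eq_sum_fibers (A : Set ((i : ι) × γ i)) :
    A.ncard = ∑ i, (Sigma.mk i ⁻¹' A).ncard := by
  classical
  have h : A.toFinset = Finset.univ.sigma fun i => (Sigma.mk i ⁻¹' A).toFinset := by
    ext ⟨i, x⟩
    simp
  simp only [Set.ncard_eq_toFinset_card']
  rw [h, Finset.card_sigma]

theorem rankInterval_sigma {r : ∀ i, Set (γ i) → ℕ} (hr : ∀ i, Monotone (r i))
    (A B : Set ((i : ι) × γ i)) :
    rankInterval (fun A => ∑ i, r i (Sigma.mk i ⁻¹' A)) A B =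
      ∏ i, rankInterval (r i) (Sigma.mk i ⁻¹' A) (Sigma.mk i ⁻¹' B) := by
  classical
  simp only [rankInterval]
  rw [← sum_sets_sigma]
  refine Finset.sum_congr ?_ fun C hC => ?_
  · ext C
    simp only [Finset.mem_filter, Finset.mem_univ, true_and, sigma_subset_iff_fibers (A := A),
      sigma_subset_iff_fibers (A := C), forall_and]
  · simp only [Finset.mem_filter, Finset.mem_univ, true_and] at hC
    rw [Finset.prod_mul_distrib, Finset.prod_pow_eq_pow_sum, Finset.prod_pow_eq_pow_sum,
      ncard_eq_sum_fibers, Finset.sum_tsub_distrib _ fun i _ => hr i (hC i).2]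
    rfl

theorem reflect_prod (s : Finset ι) (N : ι → ℕ) (p : ι → ℤ[X])
    (h : ∀ i ∈ s, (p i).natDegree ≤ N i) :
    reflect (∑ i ∈ s, N i) (∏ i ∈ s, p i) = ∏ i ∈ s, reflect (N i) (p i) := by
  classical
  induction s using Finset.induction_on with
  | empty => simp
  | insert a s ha ih =>
    rw [Finset.sum_insert ha, Finset.prod_insert ha, Finset.prod_insert ha, reflect_mul,
      ih fun i hi => h i (Finset.mem_insert_of_mem hi)]
    · exact h a (Finset.mem_insert_self a s)
    · exact (natDegree_prod_le _ _).trans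
        (Finset.sum_le_sum fun i hi => h i (Finset.mem_insert_of_mem hi))

theorem IsKL.two_mul_natDegree_le {r : Set α → ℕ} {p : Set α → ℤ[X]} (h : IsKL r p)
    (A : Set α) : 2 * (p A).natDegree ≤ r Set.univ - r A := by
  by_cases hA : A = Set.univ
  · rw [hA, h.univ]; simp
  · rcases h.deg A hA with h0 | h0
    · rw [h0]; simp
    · exact h0.le

/-- A subset of a disjoint union is a family of subsets of the fibres, so interval polynomials,
reflections and the sum over `B` all factor over the index set. -/
theorem IsKL.sigma {r : ∀ i, Set (γ i) → ℕ} {p : ∀ i, Set (γ i) → ℤ[X]}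
    (h : ∀ i, IsKL (r i) (p i)) :
    IsKL (fun A : Set ((i : ι) × γ i) => ∑ i, r i (Sigma.mk i ⁻¹' A))
      (fun A => ∏ i, p i (Sigma.mk i ⁻¹' A)) := by
  classical
  have hsub : ∀ A : Set ((i : ι) × γ i),
      ∑ i, r i (Sigma.mk i ⁻¹' Set.univ) - ∑ i, r i (Sigma.mk i ⁻¹' A) =
        ∑ i, (r i Set.univ - r i (Sigma.mk i ⁻¹' A)) := fun A => by
    simp only [Set.preimage_univ]
    rw [Finset.sum_tsub_distrib _ fun i _ => (h i).mono (Set.subset_univ _)]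
  refine ⟨fun A B hAB => Finset.sum_le_sum fun i _ => (h i).mono (Set.preimage_mono hAB), ?_,
    ?_, ?_⟩
  · simp [(h _).univ]
  · intro A hA
    by_cases h0 : ∏ i, p i (Sigma.mk i ⁻¹' A) = 0
    · exact Or.inl h0
    · right
      have hne : ∃ i, Sigma.mk i ⁻¹' A ≠ Set.univ := by
        by_contra! hall
        refine hA (Set.eq_univ_of_forall fun ⟨i, x⟩ => ?_)
        have : x ∈ Sigma.mk i ⁻¹' A := by rw [hall i]; trivial
        exact this
      obtain ⟨i, hi⟩ := hne
      simp only [hsub]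
      refine (Nat.mul_le_mul_left 2 (natDegree_prod_le _ _)).trans_lt ?_
      rw [Finset.mul_sum]
      -- The degree bound holds weakly in every fibre, and strictly in a fibre where `A` is proper,
      -- because the product is nonzero.
      refine Finset.sum_lt_sum (fun j _ => (h j).two_mul_natDegree_le _) ⟨i, Finset.mem_univ i, ?_⟩
      exact ((h i).deg _ hi).resolve_left fun hz => h0 (Finset.prod_eq_zero (Finset.mem_univ i) hz)
  · intro A
    simp only [hsub]
    rw [reflect_prod _ _ _ fun i _ => by have := (h i).two_mul_natDegree_le (Sigma.mk i ⁻¹' A); omega]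
    simp only [(h _).refl]
    rw [← sum_sets_sigma]
    refine Finset.sum_congr ?_ fun B _ => ?_
    · ext B
      simp only [Finset.mem_filter, Finset.mem_univ, true_and, sigma_subset_iff_fibers (A := A)]
    · rw [Finset.prod_mul_distrib, rankInterval_sigma fun i => (h i).mono]

theorem zeta_sigma (r : ∀ i, Set (γ i) → ℕ) (p : ∀ i, Set (γ i) → ℤ[X]) :
    zeta (fun A : Set ((i : ι) × γ i) => ∑ i, r i (Sigma.mk i ⁻¹' A))
      (fun A => ∏ i, p i (Sigma.mk i ⁻¹' A)) = ∏ i, zeta (r i) (p i) := by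
  classical
  have := sum_sets_sigma (fun (i : ι) (_ : Set (γ i)) => True) fun i C => X ^ r i C * p i C
  simp only [implies_true, Finset.filter_true] at this
  simp only [zeta]
  rw [← this]
  refine Finset.sum_congr rfl fun C _ => ?_
  rw [Finset.prod_mul_distrib, Finset.prod_pow_eq_pow_sum]

theorem setRk_sigma (M : ∀ i, Matroid (γ i)) (hM : ∀ i, (M i).E = Set.univ)
    (A : Set ((i : ι) × γ i)) :
    setRk (Matroid.sigma M) A = ∑ i, setRk (M i) (Sigma.mk i ⁻¹' A) := by
  obtain ⟨I, hI⟩ := (Matroid.sigma M).exists_isBasis A (by simp [hM])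
  rw [setRk, ← hI.encard_eq_eRk]
  change I.ncard = _
  rw [ncard_eq_sum_fibers]
  refine Finset.sum_congr rfl fun i _ => ?_
  rw [setRk, ← (Matroid.sigma_isBasis_iff.1 hI i).encard_eq_eRk]
  rfl

theorem zPoly_sigma (M : ∀ i, Matroid (γ i)) (hM : ∀ i, (M i).E = Set.univ) :
    zPoly (Matroid.sigma M) = ∏ i, zPoly (M i) := by
  have hr : setRk (Matroid.sigma M) = fun A => ∑ i, setRk (M i) (Sigma.mk i ⁻¹' A) :=
    funext (setRk_sigma M hM)
  have h := IsKL.sigma fun i => isKL_matroid (M i) (hM i)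
  rw [← hr] at h
  rw [zPoly_eq_zeta_of_isKL _ (by ext; simp [hM]) h, hr,
    zeta_sigma (fun i => setRk (M i)) fun i A => klPoly (M i ／ A)]
  exact Finset.prod_congr rfl fun i _ => (zPoly_eq_zeta _ (hM i)).symm

theorem zPoly_uniformSum {n : ℕ} (a b : ℕ) (lam : n.Partition) :
    zPoly (uniformSum a b lam) = (lam.parts.map fun i => zPoly (uniformAB i a b)).prod := by
  rw [uniformSum, zPoly_sigma _ fun i => rfl, Finset.prod_eq_multiset_prod]
  congr 1
  conv_rhs => rw [← Multiset.map_univ_coe lam.parts, Multiset.map_map]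
  rfl

end RankFunctions

/-! ### Valuativity of the `Z`-polynomial -/

section Valuative

variable {α : Type*} [Fintype α]

-- Reading the exponent `r B - r C` through an indicator makes the ranges of summation independent
-- of `r`; the rank function then enters only through its values at `B` and `C`.
open Classical in
theorem coeff_rankInterval_mul (r : Set α → ℕ) (A B : Set α) (q : ℤ[X]) (i : ℕ) :
    (rankInterval r A B * q).coeff i = ∑ C : Set α with A ⊆ C ∧ C ⊆ B,
      ∑ j ∈ Finset.range (i + 1),
        (-1) ^ (C \ A).ncard * ((if r B - r C + j = i then 1 else 0) * q.coeff j) := by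
  rw [rankInterval, Finset.sum_mul, finsetSum_coeff]
  refine Finset.sum_congr rfl fun C _ => ?_
  rw [← Finset.mul_sum, mul_assoc, neg_one_pow_eq_C, coeff_C_mul, coeff_X_pow_mul']
  congr 1
  split_ifs with h
  · rw [Finset.sum_eq_single (i - (r B - r C))]
    · rw [if_pos (by omega), one_mul]
    · intro j _ hj
      rw [if_neg (by omega), zero_mul]
    · intro hj
      exact absurd (Finset.mem_range.2 (by omega)) hj
  · symm
    refine Finset.sum_eq_zero fun j _ => ?_
    rw [if_neg (by omega), zero_mul]

variable {ι : Type*} {s : Finset ι} {c : ι → ℤ} {r : ι → Set α → ℕ} {p : ι → Set α → ℤ[X]}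
  {R : ℕ}

/-- Downward induction on the top `A` of the chain. The recursion replaces a coefficient of `p A` by
coefficients of `p B` for larger `B`, multiplied by conditions on the ranks of `A`, `C`, `B` that
are absorbed into the test function. At the full set `p` is 1 and the hypothesis applies. The total
rank enters the degree bound, and is a constant because all the rank functions share it. -/
theorem sum_mul_coeff_eq_zero (hp : ∀ k ∈ s, IsKL (r k) (p k)) (hR : ∀ k ∈ s, r k Set.univ = R)
    (H : ∀ 𝒞 : Set (Set α), IsChain (· ⊆ ·) 𝒞 → ∀ Φ : (Set α → ℕ) → ℤ, DependsOn Φ 𝒞 →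
      ∑ k ∈ s, c k * Φ (r k) = 0)
    (A : Set α) (𝒞 : Set (Set α)) (h𝒞 : IsChain (· ⊆ ·) 𝒞) (hle : ∀ C ∈ 𝒞, C ⊆ A) (hA : A ∈ 𝒞)
    (Φ : (Set α → ℕ) → ℤ) (hΦ : DependsOn Φ 𝒞) (i : ℕ) :
    ∑ k ∈ s, c k * (Φ (r k) * (p k A).coeff i) = 0 := by
  classical
  induction hn : Aᶜ.ncard using Nat.strong_induction_on generalizing A 𝒞 Φ i with
  | _ n ih =>
  by_cases hAu : A = Set.univ
  · rw [← H 𝒞 h𝒞 (fun f => Φ f * (1 : ℤ[X]).coeff i) fun x y hxy => by simp only [hΦ hxy]]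
    refine Finset.sum_congr rfl fun k hk => ?_
    rw [hAu, (hp k hk).univ]
  -- One term of the expanded recursion. All of `𝒞` lies below `A`, so adding `C` and `B` on top
  -- keeps it a chain.
  have key : ∀ B C : Set α, A ⊂ B → A ⊆ C → C ⊆ B → ∀ j,
      ∑ k ∈ s, c k * (Φ (r k) * (if 2 * i < R - r k A then 1 else 0) *
        (if r k B - r k C + j = i then 1 else 0) * (p k B).coeff j) = 0 := by
    intro B C hAB hAC hCB j
    refine ih _ ?_ B (insert B (insert C 𝒞)) ?_ ?_ (Set.mem_insert _ _)
      (fun f => Φ f * (if 2 * i < R - f A then 1 else 0) *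
        (if f B - f C + j = i then 1 else 0)) ?_ j rfl
    · rw [← hn]
      exact Set.ncard_lt_ncard (compl_lt_compl_iff_lt.2 hAB)
    · refine (h𝒞.insert fun D hD _ => Or.inr ((hle D hD).trans hAC)).insert fun D hD _ => Or.inr ?_
      rcases hD with rfl | hD
      · exact hCB
      · exact (hle D hD).trans hAB.subset
    · rintro D (rfl | rfl | hD)
      · exact subset_rfl
      · exact hCB
      · exact (hle D hD).trans hAB.subset
    · intro x y hxy
      simp only
      rw [hΦ fun D hD => hxy D (Or.inr (Or.inr hD)), hxy B (Or.inl rfl),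
        hxy C (Or.inr (Or.inl rfl)), hxy A (Or.inr (Or.inr hA))]
  have expand : ∀ k ∈ s, c k * (Φ (r k) * (p k A).coeff i) =
      -∑ B : Set α with A ⊂ B, ∑ C : Set α with A ⊆ C ∧ C ⊆ B, ∑ j ∈ Finset.range (i + 1),
        (-1) ^ (C \ A).ncard * (c k * (Φ (r k) * (if 2 * i < R - r k A then 1 else 0) *
        (if r k B - r k C + j = i then 1 else 0) * (p k B).coeff j)) := by
    intro k hk
    rw [(hp k hk).coeff_eq hAu, hR k hk]
    simp only [coeff_rankInterval_mul]
    split_ifs with hi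
    · rw [← mul_assoc, mul_neg, Finset.mul_sum]
      congr 1
      refine Finset.sum_congr rfl fun B _ => ?_
      rw [Finset.mul_sum]
      refine Finset.sum_congr rfl fun C _ => ?_
      rw [Finset.mul_sum]
      refine Finset.sum_congr rfl fun j _ => ?_
      ring
    · simp
  rw [Finset.sum_congr rfl expand, Finset.sum_neg_distrib, neg_eq_zero, Finset.sum_comm]
  refine Finset.sum_eq_zero fun B hB => ?_
  rw [Finset.sum_comm]
  refine Finset.sum_eq_zero fun C hC => ?_
  rw [Finset.sum_comm]
  refine Finset.sum_eq_zero fun j _ => ?_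
  simp only [Finset.mem_filter, Finset.mem_univ, true_and] at hB hC
  rw [← Finset.mul_sum, key B C hB hC.1 hC.2 j, mul_zero]

/-- A linear relation between the rank functions which holds on every chain of sets holds
between the `Z`-polynomials. -/
theorem sum_zeta_eq_zero (hp : ∀ k ∈ s, IsKL (r k) (p k)) (hR : ∀ k ∈ s, r k Set.univ = R)
    (H : ∀ 𝒞 : Set (Set α), IsChain (· ⊆ ·) 𝒞 → ∀ Φ : (Set α → ℕ) → ℤ, DependsOn Φ 𝒞 →
      ∑ k ∈ s, c k * Φ (r k) = 0) :
    ∑ k ∈ s, C (c k) * zeta (r k) (p k) = 0 := by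
  classical
  ext i
  have expand : ∀ k ∈ s, (C (c k) * zeta (r k) (p k)).coeff i =
      ∑ A : Set α, ∑ j ∈ Finset.range (i + 1),
        c k * ((if r k A + j = i then 1 else 0) * (p k A).coeff j) := by
    intro k _
    rw [zeta, coeff_C_mul, finsetSum_coeff, Finset.mul_sum]
    refine Finset.sum_congr rfl fun A _ => ?_
    rw [← Finset.mul_sum, coeff_X_pow_mul']
    congr 1
    split_ifs with h
    · rw [Finset.sum_eq_single (i - r k A)]
      · rw [if_pos (by omega), one_mul]
      · intro j _ hj
        rw [if_neg (by omega), zero_mul]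
      · intro hj
        exact absurd (Finset.mem_range.2 (by omega)) hj
    · symm
      refine Finset.sum_eq_zero fun j _ => ?_
      rw [if_neg (by omega), zero_mul]
  rw [finsetSum_coeff, Finset.sum_congr rfl expand, coeff_zero, Finset.sum_comm]
  refine Finset.sum_eq_zero fun A _ => ?_
  rw [Finset.sum_comm]
  refine Finset.sum_eq_zero fun j _ => ?_
  refine sum_mul_coeff_eq_zero hp hR H A {A} IsChain.singleton (by simp) rfl
    (fun f => if f A + j = i then 1 else 0) ?_ j
  intro x y hxy
  simp only
  rw [hxy A rfl]

end Valuative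

/-! ### Orderings and set partitions of a finite set of blocks -/

section Orderings

set_option linter.unusedSectionVars false

variable {ι : Type*} [DecidableEq ι]

/-- The orderings of a finite set, as lists without repetition. -/
noncomputable def orderings (S : Finset ι) : Finset (List ι) := S.toList.permutations.toFinset

theorem mem_orderings {S : Finset ι} {L : List ι} :
    L ∈ orderings S ↔ L.Nodup ∧ ∀ i, i ∈ L ↔ i ∈ S := by
  rw [orderings, List.mem_toFinset, List.mem_permutations]
  constructor
  · intro h
    exact ⟨h.nodup_iff.2 S.nodup_toList, fun i => by rw [h.mem_iff, Finset.mem_toList]⟩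
  · rintro ⟨h1, h2⟩
    rw [List.perm_ext_iff_of_nodup h1 S.nodup_toList]
    intro i
    rw [h2, Finset.mem_toList]

theorem card_orderings (S : Finset ι) : (orderings S).card = S.card.factorial := by
  rw [orderings, List.toFinset_card_of_nodup (List.nodup_permutations_iff.2 S.nodup_toList),
    List.length_permutations, Finset.length_toList]

theorem sum_map_of_mem_orderings {R : Type*} [AddCommMonoid R] {S : Finset ι} {L : List ι}
    (h : L ∈ orderings S) (f : ι → R) : (L.map f).sum = ∑ i ∈ S, f i := by
  rw [mem_orderings] at h
  have : S = L.toFinset := by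
    ext i
    rw [List.mem_toFinset, h.2]
  rw [this, List.sum_toFinset _ h.1]

theorem append_mem_orderings {S Y : Finset ι} (hY : Y ⊆ S) {L₁ L₂ : List ι}
    (h₁ : L₁ ∈ orderings Y) (h₂ : L₂ ∈ orderings (S \ Y)) : L₁ ++ L₂ ∈ orderings S := by
  rw [mem_orderings] at *
  refine ⟨List.nodup_append'.2 ⟨h₁.1, h₂.1, fun i hi hi' => ?_⟩, fun i => ?_⟩
  · exact (Finset.mem_sdiff.1 ((h₂.2 i).1 hi')).2 ((h₁.2 i).1 hi)
  · rw [List.mem_append, h₁.2, h₂.2, Finset.mem_sdiff]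
    constructor
    · rintro (h | h)
      · exact hY h
      · exact h.1
    · intro h
      by_cases hi : i ∈ Y
      · exact Or.inl hi
      · exact Or.inr ⟨h, hi⟩

theorem split_mem_orderings {S : Finset ι} {L₁ L₂ : List ι} (h : L₁ ++ L₂ ∈ orderings S) :
    L₁.toFinset ⊆ S ∧ L₁ ∈ orderings L₁.toFinset ∧ L₂ ∈ orderings (S \ L₁.toFinset) := by
  simp only [mem_orderings, List.mem_toFinset, Finset.mem_sdiff] at *
  obtain ⟨h1, h2⟩ := h
  rw [List.nodup_append'] at h1
  refine ⟨fun i hi => (h2 i).1 (List.mem_append_left _ (List.mem_toFinset.1 hi)),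
    ⟨h1.1, by simp⟩, h1.2.1, fun i => ?_⟩
  rw [← h2, List.mem_append]
  constructor
  · exact fun hi => ⟨Or.inr hi, fun hi' => h1.2.2 hi' hi⟩
  · exact fun hi => hi.1.resolve_left hi.2

theorem toFinset_of_mem_orderings {S : Finset ι} {L : List ι} (h : L ∈ orderings S) :
    L.toFinset = S := by
  ext i
  rw [List.mem_toFinset, (mem_orderings.1 h).2]

theorem prefix_append_cases {T A B : List ι} (h : T <+: A ++ B) :
    T <+: A ∨ ∃ T', T = A ++ T' ∧ T' <+: B := by
  rcases List.prefix_or_prefix_of_prefix h (List.prefix_append A B) with h' | ⟨T', rfl⟩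
  · exact Or.inl h'
  · exact Or.inr ⟨T', rfl, (List.prefix_append_right_inj A).1 h⟩

variable (y : ι → ℤ) (prec : ι → ι → Prop)

/-- The partial sums of `y` along `L` are nonpositive, and the first one to vanish after `x` has
occurred is the whole sum. -/
def IsFirstReturn (x : ι) (L : List ι) : Prop :=
  x ∈ L ∧ (L.map y).sum = 0 ∧ ∀ T, T <+: L → (T.map y).sum ≤ 0 ∧
    (x ∈ T → (T.map y).sum = 0 → T = L)

/-- The partial sums of `y` along `L` are nonpositive, the total is zero, and each `i` in `L` lies
in a prefix of sum zero whose elements are all related to `i`. -/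
def IsAdmissible (L : List ι) : Prop :=
  (L.map y).sum = 0 ∧ (∀ T, T <+: L → (T.map y).sum ≤ 0) ∧
    ∀ i ∈ L, ∃ T, T <+: L ∧ i ∈ T ∧ (T.map y).sum = 0 ∧ ∀ k ∈ T, prec k i

/-- `y` sums to zero over `Y`, and all elements of `Y` are related. -/
def IsBalanced (Y : Finset ι) : Prop :=
  ∑ i ∈ Y, y i = 0 ∧ ∀ i ∈ Y, ∀ j ∈ Y, prec i j

/-- Cut a list at `x`, exchange the two sides, and drop `x`. -/
def cutAt (x : ι) (L : List ι) : List ι :=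
  (L.dropWhile (· ≠ x)).tail ++ L.takeWhile (· ≠ x)

theorem cutAt_append {x : ι} {V A : List ι} (h : x ∉ V) : cutAt x (V ++ x :: A) = A ++ V := by
  have h' : ∀ v ∈ V, decide (v ≠ x) = true := fun v hv => by
    simp only [ne_eq, decide_eq_true_eq]
    rintro rfl
    exact h hv
  rw [cutAt, List.dropWhile_append_of_pos h', List.takeWhile_append_of_pos h']
  simp

variable {y}

/-- Uniqueness in the cycle lemma. If `A = A' ++ M` with `M` nonempty, then `M` is a prefix of `V'`
and has sum at most 0; but removing `M` from the end of the first return `V ++ x :: A` leaves a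
proper prefix containing `x`, whose sum is negative, so `M` has positive sum. -/
theorem IsFirstReturn.length_le {x : ι} {V A V' A' : List ι}
    (h : IsFirstReturn y x (V ++ x :: A)) (h' : IsFirstReturn y x (V' ++ x :: A'))
    (he : A ++ V = A' ++ V') : A.length ≤ A'.length := by
  by_contra! hlt
  obtain ⟨M, rfl⟩ : A' <+: A :=
    List.prefix_of_prefix_length_le ⟨V', he.symm⟩ ⟨V, rfl⟩ hlt.le
  rw [List.append_assoc, List.append_cancel_left_eq] at he
  have hM : M ≠ [] := by
    rintro rfl
    simp at hlt
  have h1 := (h'.2.2 M ⟨V ++ x :: A', by rw [← he]; simp⟩).1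
  have h2 := h.2.2 (V ++ x :: A') ⟨M, by simp⟩
  have h3 : ((V ++ x :: A').map y).sum ≠ 0 := by
    intro h0
    have := h2.2 (by simp) h0
    simp only [List.append_cancel_left_eq, List.cons.injEq, true_and] at this
    exact hM (List.append_cancel_left (as := A') (by simpa using this.symm))
  have h4 := h.2.1
  have h5 := h2.1
  simp only [List.map_append, List.map_cons, List.sum_append, List.sum_cons] at h3 h4 h5
  omega

/-- The strict inequality singles out the shortest prefix of maximal sum, which is where the cyclic
ordering has to be cut. -/
theorem exists_prefix_sum_max (L : List ι) : ∃ A, A <+: L ∧ (∀ T, T <+: L →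
    (T.map y).sum ≤ (A.map y).sum ∧ (T.length < A.length → (T.map y).sum < (A.map y).sum)) := by
  induction L using List.reverseRecOn with
  | nil => exact ⟨[], List.prefix_rfl, fun T hT => by simp [List.prefix_nil.1 hT]⟩
  | append_singleton L a ih =>
    obtain ⟨A, hA, hmax⟩ := ih
    by_cases h : ((L ++ [a]).map y).sum ≤ (A.map y).sum
    · refine ⟨A, hA.trans (List.prefix_append _ _), fun T hT => ?_⟩
      rcases List.prefix_concat_iff.1 hT with rfl | hT
      · refine ⟨h, fun hl => ?_⟩
        have := hA.length_le
        simp at hl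
        omega
      · exact hmax T hT
    · refine ⟨L ++ [a], List.prefix_rfl, fun T hT => ?_⟩
      rcases List.prefix_concat_iff.1 hT with rfl | hT
      · exact ⟨le_rfl, fun hl => absurd hl (lt_irrefl _)⟩
      · have := (hmax T hT).1
        exact ⟨by omega, fun _ => by omega⟩

/-- After the rotation, every prefix sum is the sum of a prefix of `A ++ V` minus the maximum
`(A.map y).sum`, hence nonpositive. It vanishes after `x` only at another maximiser, which must then
be at least as long as `A`. -/
theorem isFirstReturn_of_max {x : ι} {V A : List ι} (hx : x ∉ V)
    (h0 : ((A ++ V).map y).sum + y x = 0)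
    (hmax : ∀ T, T <+: A ++ V → (T.map y).sum ≤ (A.map y).sum ∧
      (T.length < A.length → (T.map y).sum < (A.map y).sum)) :
    IsFirstReturn y x (V ++ x :: A) := by
  simp only [List.map_append, List.sum_append] at h0
  refine ⟨by simp, ?_, fun T hT => ?_⟩
  · simp only [List.map_append, List.map_cons, List.sum_append, List.sum_cons]
    omega
  · rcases prefix_append_cases hT with hT | ⟨T', rfl, hT'⟩
    · refine ⟨?_, fun hxT => absurd (hT.subset hxT) hx⟩
      have := (hmax (A ++ T) ((List.prefix_append_right_inj A).2 hT)).1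
      simp only [List.map_append, List.sum_append] at this
      omega
    · rcases T' with _ | ⟨z, T'⟩
      · refine ⟨?_, fun hxT => absurd (by simpa using hxT) hx⟩
        have := (hmax (A ++ V) List.prefix_rfl).1
        simp only [List.map_append, List.sum_append] at this
        simp only [List.append_nil]
        omega
      · rw [List.cons_prefix_cons] at hT'
        obtain ⟨rfl, hT'⟩ := hT'
        have h1 := hmax T' (hT'.trans (List.prefix_append _ _))
        simp only [List.map_append, List.map_cons, List.sum_append, List.sum_cons]
        refine ⟨by omega, fun _ hz => ?_⟩
        have h2 : ¬ T'.length < A.length := fun hl => by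
          have := h1.2 hl
          omega
        rw [hT'.eq_of_length_le (by omega)]

/-- The cycle lemma: among the orderings of a set of total weight zero, those that are a first
return at `x` represent each cyclic ordering once. -/
theorem card_isFirstReturn {Y : Finset ι} {x : ι} (hx : x ∈ Y) (hY : ∑ i ∈ Y, y i = 0)
    [DecidablePred (IsFirstReturn y x)] :
    ((orderings Y).filter (IsFirstReturn y x)).card = (Y.card - 1).factorial := by
  rw [← Finset.card_erase_of_mem hx, ← card_orderings]
  have hsplit : ∀ L ∈ orderings Y, ∃ V A, L = V ++ x :: A ∧ x ∉ V ∧ x ∉ A := by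
    intro L hL
    rw [mem_orderings] at hL
    obtain ⟨V, A, rfl⟩ := List.append_of_mem ((hL.2 x).2 hx)
    have := hL.1
    rw [List.nodup_append'] at this
    refine ⟨V, A, rfl, fun h => this.2.2 h (by simp), (List.nodup_cons.1 this.2.1).1⟩
  -- Cutting the cycle at `x` identifies cyclic orderings of `Y` with linear orderings of `Y.erase
  -- x`.
  refine Finset.card_bij (fun L _ => cutAt x L) ?_ ?_ ?_
  · intro L hL
    rw [Finset.mem_filter] at hL
    obtain ⟨V, A, rfl, hV, hA⟩ := hsplit L hL.1
    rw [cutAt_append hV, mem_orderings]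
    obtain ⟨h1, h2⟩ := mem_orderings.1 hL.1
    have hp : (V ++ x :: A).Perm (x :: (A ++ V)) :=
      List.perm_middle.trans (List.Perm.cons x List.perm_append_comm)
    rw [hp.nodup_iff, List.nodup_cons] at h1
    refine ⟨h1.2, fun i => ?_⟩
    rw [Finset.mem_erase, ← h2, hp.mem_iff, List.mem_cons]
    constructor
    · exact fun hi => ⟨fun h => h1.1 (h ▸ hi), Or.inr hi⟩
    · exact fun hi => hi.2.resolve_left hi.1
  · intro L hL L' hL' he
    rw [Finset.mem_filter] at hL hL'
    obtain ⟨V, A, rfl, hV, hA⟩ := hsplit L hL.1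
    obtain ⟨V', A', rfl, hV', hA'⟩ := hsplit L' hL'.1
    rw [cutAt_append hV, cutAt_append hV'] at he
    have h1 := IsFirstReturn.length_le hL.2 hL'.2 he
    have h2 := IsFirstReturn.length_le hL'.2 hL.2 he.symm
    obtain ⟨h3, h4⟩ := List.append_inj he (le_antisymm h1 h2)
    rw [h3, h4]
  · intro L hL
    obtain ⟨A, ⟨V, rfl⟩, hmax⟩ := exists_prefix_sum_max (y := y) L
    have hs := sum_map_of_mem_orderings hL y
    obtain ⟨h1, h2⟩ := mem_orderings.1 hL
    have hxL : x ∉ A ++ V := fun h => by simpa using (h2 x).1 h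
    have hxV : x ∉ V := fun h => hxL (List.mem_append_right _ h)
    have hp : (V ++ x :: A).Perm (x :: (A ++ V)) :=
      List.perm_middle.trans (List.Perm.cons x List.perm_append_comm)
    refine ⟨V ++ x :: A, ?_, cutAt_append hxV⟩
    rw [Finset.mem_filter, mem_orderings, hp.nodup_iff, List.nodup_cons]
    refine ⟨⟨⟨hxL, h1⟩, fun i => ?_⟩, isFirstReturn_of_max hxV ?_ hmax⟩
    · rw [hp.mem_iff, List.mem_cons, h2, Finset.mem_erase]
      constructor
      · rintro (rfl | h)
        · exact hx
        · exact h.2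
      · intro h
        by_cases hi : i = x
        · exact Or.inl hi
        · exact Or.inr ⟨hi, h⟩
    · rw [hs, Finset.sum_erase_add _ _ hx, hY]

variable {prec}

theorem IsAdmissible.append {x : ι} {L₁ L₂ : List ι} (h₁ : IsFirstReturn y x L₁)
    (hb : ∀ i ∈ L₁, ∀ j ∈ L₁, prec i j) (h₂ : IsAdmissible y prec L₂)
    (hx : ∀ j ∈ L₂, ∀ i, prec i x → prec i j) : IsAdmissible y prec (L₁ ++ L₂) := by
  refine ⟨?_, fun T hT => ?_, fun i hi => ?_⟩
  · rw [List.map_append, List.sum_append, h₁.2.1, h₂.1, add_zero]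
  · rcases prefix_append_cases hT with hT | ⟨T', rfl, hT'⟩
    · exact (h₁.2.2 T hT).1
    · rw [List.map_append, List.sum_append, h₁.2.1, zero_add]
      exact h₂.2.1 T' hT'
  · rcases List.mem_append.1 hi with hi | hi
    · exact ⟨L₁, List.prefix_append _ _, hi, h₁.2.1, fun k hk => hb k hk i hi⟩
    · obtain ⟨T, hT, hiT, hT0, hprec⟩ := h₂.2.2 i hi
      refine ⟨L₁ ++ T, (List.prefix_append_right_inj L₁).2 hT, List.mem_append_right _ hiT, ?_, ?_⟩
      · rw [List.map_append, List.sum_append, h₁.2.1, hT0, add_zero]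
      · intro k hk
        rcases List.mem_append.1 hk with hk | hk
        · exact hx i hi k (hb k hk x h₁.1)
        · exact hprec k hk

/-- `L₁` is the shortest prefix of sum zero containing `x`. It lies inside the prefix that
admissibility provides for `x`, so its members are related to `x`, hence by the choice of `x` to
everything. A prefix of sum zero that contains an element of `L₂` must contain all of `L₁`, and
removing `L₁` keeps the sum zero. -/
theorem IsAdmissible.exists_split {x : ι} {L : List ι} (h : IsAdmissible y prec L)
    (hL : L.Nodup) (hxL : x ∈ L) (hx : ∀ j ∈ L, ∀ i, prec i x → prec i j) :
    ∃ L₁ L₂, L = L₁ ++ L₂ ∧ IsFirstReturn y x L₁ ∧ (∀ i ∈ L₁, ∀ j ∈ L₁, prec i j) ∧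
      IsAdmissible y prec L₂ := by
  classical
  have hex : ∃ n, ∃ T, T <+: L ∧ x ∈ T ∧ (T.map y).sum = 0 ∧ T.length = n :=
    ⟨_, L, List.prefix_rfl, hxL, h.1, rfl⟩
  obtain ⟨L₁, ⟨L₂, rfl⟩, hx₁, h₁, hlen⟩ := Nat.find_spec hex
  have hmin : ∀ T, T <+: L₁ ++ L₂ → x ∈ T → (T.map y).sum = 0 → L₁ <+: T := by
    intro T hT hxT hT0
    refine List.prefix_of_prefix_length_le (List.prefix_append _ _) hT ?_
    rw [hlen]
    exact Nat.find_min' hex ⟨T, hT, hxT, hT0, rfl⟩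
  refine ⟨L₁, L₂, rfl, ⟨hx₁, h₁, fun T hT => ?_⟩, fun i hi j hj => ?_, ?_, fun T hT => ?_,
    fun i hi => ?_⟩
  · have hT' := hT.trans (List.prefix_append L₁ L₂)
    exact ⟨h.2.1 T hT', fun hxT hT0 => hT.eq_of_length_le (hmin T hT' hxT hT0).length_le⟩
  · obtain ⟨T, hT, hxT, hT0, hprec⟩ := h.2.2 x hxL
    exact hx j (List.mem_append_left _ hj) i (hprec i ((hmin T hT hxT hT0).subset hi))
  · have := h.1
    rwa [List.map_append, List.sum_append, h₁, zero_add] at this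
  · have := h.2.1 (L₁ ++ T) ((List.prefix_append_right_inj L₁).2 hT)
    rwa [List.map_append, List.sum_append, h₁, zero_add] at this
  · obtain ⟨T, hT, hiT, hT0, hprec⟩ := h.2.2 i (List.mem_append_right _ hi)
    rcases prefix_append_cases hT with hT | ⟨T', rfl, hT'⟩
    · exact absurd hi ((List.nodup_append'.1 hL).2.2 (hT.subset hiT))
    · refine ⟨T', hT', ?_, ?_, fun k hk => hprec k (List.mem_append_right _ hk)⟩
      · exact (List.mem_append.1 hiT).resolve_left
          fun hi' => (List.nodup_append'.1 hL).2.2 hi' hi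
      · rwa [List.map_append, List.sum_append, h₁, zero_add] at hT0

-- The split is reversible by `IsAdmissible.append`, so admissible orderings correspond to a
-- balanced set `Y` containing `x`, a first return on `Y`, and an admissible ordering of the rest;
-- the cycle lemma counts the middle factor.
open Classical in
theorem card_isAdmissible_rec {S : Finset ι} {x : ι} (hxS : x ∈ S)
    (hx : ∀ j ∈ S, ∀ i, prec i x → prec i j) :
    ((orderings S).filter (IsAdmissible y prec)).card =
      ∑ Y ∈ S.powerset with x ∈ Y ∧ IsBalanced y prec Y,
        (Y.card - 1).factorial * ((orderings (S \ Y)).filter (IsAdmissible y prec)).card := by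
  have h1 : ∑ Y ∈ S.powerset with x ∈ Y ∧ IsBalanced y prec Y,
        (Y.card - 1).factorial * ((orderings (S \ Y)).filter (IsAdmissible y prec)).card =
      ∑ Y ∈ S.powerset with x ∈ Y ∧ IsBalanced y prec Y,
        (((orderings Y).filter (IsFirstReturn y x)) ×ˢ
          ((orderings (S \ Y)).filter (IsAdmissible y prec))).card := by
    refine Finset.sum_congr rfl fun Y hY => ?_
    rw [Finset.mem_filter] at hY
    rw [Finset.card_product, card_isFirstReturn hY.2.1 hY.2.2.1]
  rw [h1, ← Finset.card_sigma]
  symm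
  refine Finset.card_bij (fun q _ => q.2.1 ++ q.2.2) ?_ ?_ ?_
  · rintro ⟨Y, L₁, L₂⟩ hq
    simp only [Finset.mem_sigma, Finset.mem_filter, Finset.mem_powerset, Finset.mem_product] at hq
    obtain ⟨⟨hYS, hxY, hY⟩, ⟨h1, hr⟩, h2, ha⟩ := hq
    refine Finset.mem_filter.2 ⟨append_mem_orderings hYS h1 h2, IsAdmissible.append hr ?_ ha ?_⟩
    · intro i hi j hj
      exact hY.2 i (((mem_orderings.1 h1).2 i).1 hi) j (((mem_orderings.1 h1).2 j).1 hj)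
    · intro j hj
      exact hx j (Finset.mem_sdiff.1 (((mem_orderings.1 h2).2 j).1 hj)).1
  · rintro ⟨Y, L₁, L₂⟩ hq ⟨Y', L₁', L₂'⟩ hq' he
    simp only [Finset.mem_sigma, Finset.mem_filter, Finset.mem_powerset, Finset.mem_product]
      at hq hq' he
    obtain ⟨-, ⟨h1, hr⟩, -⟩ := hq
    obtain ⟨-, ⟨h1', hr'⟩, -⟩ := hq'
    -- Both are prefixes of one list; the shorter already contains `x` and has sum zero, so the
    -- longer, being a first return, equals it.
    have hL : L₁ = L₁' := by
      rcases List.prefix_or_prefix_of_prefix (List.prefix_append L₁ L₂)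
        (he ▸ List.prefix_append L₁' L₂') with h | h
      · exact (hr'.2.2 L₁ h).2 hr.1 hr.2.1
      · exact ((hr.2.2 L₁' h).2 hr'.1 hr'.2.1).symm
    subst hL
    have hY : Y = Y' := by rw [← toFinset_of_mem_orderings h1, ← toFinset_of_mem_orderings h1']
    subst hY
    rw [List.append_cancel_left he]
  · intro L hL
    rw [Finset.mem_filter] at hL
    have hmem := (mem_orderings.1 hL.1).2
    obtain ⟨L₁, L₂, rfl, hr, hb, ha⟩ := hL.2.exists_split (mem_orderings.1 hL.1).1
      ((hmem x).2 hxS) fun j hj => hx j ((hmem j).1 hj)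
    obtain ⟨h1, h2, h3⟩ := split_mem_orderings hL.1
    refine ⟨⟨L₁.toFinset, L₁, L₂⟩, ?_, rfl⟩
    simp only [Finset.mem_sigma, Finset.mem_filter, Finset.mem_powerset, Finset.mem_product]
    refine ⟨⟨h1, List.mem_toFinset.2 hr.1, ?_, ?_⟩, ⟨h2, hr⟩, h3, ha⟩
    · rw [← sum_map_of_mem_orderings h2, hr.2.1]
    · intro i hi j hj
      exact hb i (List.mem_toFinset.1 hi) j (List.mem_toFinset.1 hj)

end Orderings

/-! ### Set partitions and the exponential formula. -/

section SetPartitions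

set_option linter.unusedSectionVars false

variable {ι : Type*} [DecidableEq ι]

open Classical in
/-- The partitions of `S` into nonempty sets. -/
noncomputable def setPartitions (S : Finset ι) : Finset (Finset (Finset ι)) :=
  S.powerset.powerset.filter fun P => ∅ ∉ P ∧ ∀ i ∈ S, ∃! Y, Y ∈ P ∧ i ∈ Y

theorem mem_setPartitions {S : Finset ι} {P : Finset (Finset ι)} :
    P ∈ setPartitions S ↔ (∀ Y ∈ P, Y ⊆ S) ∧ ∅ ∉ P ∧ ∀ i ∈ S, ∃! Y, Y ∈ P ∧ i ∈ Y := by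
  simp only [setPartitions, Finset.mem_filter, Finset.mem_powerset]
  refine and_congr_left fun _ => ?_
  simp only [Finset.subset_iff, Finset.mem_powerset]

theorem setPartitions_empty : setPartitions (∅ : Finset ι) = {∅} := by
  ext P
  rw [mem_setPartitions, Finset.mem_singleton]
  constructor
  · rintro ⟨h1, h2, -⟩
    refine Finset.eq_empty_of_forall_notMem fun Y hY => h2 ?_
    rwa [← Finset.subset_empty.1 (h1 Y hY)]
  · rintro rfl
    simp

theorem eq_of_mem_setPartitions {S : Finset ι} {P : Finset (Finset ι)} (hP : P ∈ setPartitions S)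
    {Y Z : Finset ι} (hY : Y ∈ P) (hZ : Z ∈ P) {i : ι} (hiY : i ∈ Y) (hiZ : i ∈ Z) : Y = Z := by
  rw [mem_setPartitions] at hP
  exact (hP.2.2 i (hP.1 Y hY hiY)).unique ⟨hY, hiY⟩ ⟨hZ, hiZ⟩

theorem insert_mem_setPartitions {S Y : Finset ι} {Q : Finset (Finset ι)} (hYS : Y ⊆ S)
    (hY : Y.Nonempty) (hQ : Q ∈ setPartitions (S \ Y)) : insert Y Q ∈ setPartitions S := by
  rw [mem_setPartitions] at *
  obtain ⟨h1, h2, h3⟩ := hQ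
  refine ⟨fun Z hZ => ?_, fun h => ?_, fun i hi => ?_⟩
  · rcases Finset.mem_insert.1 hZ with rfl | hZ
    · exact hYS
    · exact (h1 Z hZ).trans Finset.sdiff_subset
  · rcases Finset.mem_insert.1 h with h | h
    · exact hY.ne_empty h.symm
    · exact h2 h
  · by_cases hiY : i ∈ Y
    · refine ⟨Y, ⟨Finset.mem_insert_self _ _, hiY⟩, ?_⟩
      rintro Z ⟨hZ, hiZ⟩
      rcases Finset.mem_insert.1 hZ with rfl | hZ
      · rfl
      · exact absurd hiY (Finset.mem_sdiff.1 (h1 Z hZ hiZ)).2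
    · obtain ⟨Z, ⟨hZ, hiZ⟩, hu⟩ := h3 i (Finset.mem_sdiff.2 ⟨hi, hiY⟩)
      refine ⟨Z, ⟨Finset.mem_insert_of_mem hZ, hiZ⟩, ?_⟩
      rintro W ⟨hW, hiW⟩
      rcases Finset.mem_insert.1 hW with rfl | hW
      · exact absurd hiW hiY
      · exact hu W ⟨hW, hiW⟩

theorem notMem_of_mem_setPartitions_sdiff {S Y : Finset ι} {Q : Finset (Finset ι)} {i : ι}
    (hi : i ∈ Y) (hQ : Q ∈ setPartitions (S \ Y)) : ∀ Z ∈ Q, i ∉ Z := fun Z hZ hiZ =>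
  (Finset.mem_sdiff.1 ((mem_setPartitions.1 hQ).1 Z hZ hiZ)).2 hi

theorem erase_mem_setPartitions {S Y : Finset ι} {P : Finset (Finset ι)} (hY : Y ∈ P)
    (hP : P ∈ setPartitions S) : P.erase Y ∈ setPartitions (S \ Y) := by
  have heq := fun Z (hZ : Z ∈ P) i => eq_of_mem_setPartitions (i := i) hP hY hZ
  rw [mem_setPartitions] at *
  obtain ⟨h1, h2, h3⟩ := hP
  refine ⟨fun Z hZ i hi => ?_, fun h => h2 (Finset.mem_of_mem_erase h), fun i hi => ?_⟩
  · rw [Finset.mem_erase] at hZ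
    exact Finset.mem_sdiff.2 ⟨h1 Z hZ.2 hi, fun hi' => hZ.1 (heq Z hZ.2 i hi' hi).symm⟩
  · rw [Finset.mem_sdiff] at hi
    obtain ⟨Z, ⟨hZ, hiZ⟩, hu⟩ := h3 i hi.1
    refine ⟨Z, ⟨Finset.mem_erase.2 ⟨fun h => hi.2 (h ▸ hiZ), hZ⟩, hiZ⟩, ?_⟩
    rintro W ⟨hW, hiW⟩
    exact hu W ⟨Finset.mem_of_mem_erase hW, hiW⟩

/-- The sum over set partitions of a product over the parts, split by the part containing `x`. -/
theorem sum_setPartitions_rec {R : Type*} [CommSemiring R] (f : Finset ι → R) {S : Finset ι}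
    {x : ι} (hx : x ∈ S) :
    ∑ P ∈ setPartitions S, ∏ Y ∈ P, f Y =
      ∑ Y ∈ S.powerset with x ∈ Y, f Y * ∑ Q ∈ setPartitions (S \ Y), ∏ Z ∈ Q, f Z := by
  simp only [Finset.mul_sum]
  rw [Finset.sum_sigma']
  symm
  have hnot : ∀ Y : Finset ι, x ∈ Y → ∀ Q ∈ setPartitions (S \ Y), Y ∉ Q := fun Y hY Q hQ h =>
    notMem_of_mem_setPartitions_sdiff hY hQ Y h hY
  refine Finset.sum_bij (fun q _ => insert q.1 q.2) ?_ ?_ ?_ ?_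
  · rintro ⟨Y, Q⟩ hq
    simp only [Finset.mem_sigma, Finset.mem_filter, Finset.mem_powerset] at hq
    exact insert_mem_setPartitions hq.1.1 ⟨x, hq.1.2⟩ hq.2
  · rintro ⟨Y, Q⟩ hq ⟨Y', Q'⟩ hq' he
    simp only [Finset.mem_sigma, Finset.mem_filter, Finset.mem_powerset] at hq hq' he
    have hY : Y = Y' := by
      have : Y ∈ insert Y' Q' := he ▸ Finset.mem_insert_self Y Q
      rcases Finset.mem_insert.1 this with h | h
      · exact h
      · exact absurd hq.1.2 (notMem_of_mem_setPartitions_sdiff hq'.1.2 hq'.2 Y h)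
    subst hY
    rw [← Finset.erase_insert (hnot Y hq.1.2 Q hq.2), he,
      Finset.erase_insert (hnot Y hq.1.2 Q' hq'.2)]
  · intro P hP
    obtain ⟨Y, ⟨hY, hxY⟩, -⟩ := (mem_setPartitions.1 hP).2.2 x hx
    refine ⟨⟨Y, P.erase Y⟩, ?_, Finset.insert_erase hY⟩
    simp only [Finset.mem_sigma, Finset.mem_filter, Finset.mem_powerset]
    exact ⟨⟨(mem_setPartitions.1 hP).1 Y hY, hxY⟩, erase_mem_setPartitions hY hP⟩
  · rintro ⟨Y, Q⟩ hq
    simp only [Finset.mem_sigma, Finset.mem_filter, Finset.mem_powerset] at hq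
    simp only
    rw [Finset.prod_insert (hnot Y hq.1.2 Q hq.2)]

/-- The number of permutations with the parts of `P` as their cycles. -/
def cycleWeight (P : Finset (Finset ι)) : ℕ := ∏ Y ∈ P, (Y.card - 1).factorial

variable {y : ι → ℤ} {prec : ι → ι → Prop}

-- Both sides satisfy the same recursion, removing the part or the initial segment that contains
-- `x`. The hypothesis is needed for every `S`, since a new `x` is chosen at each stage.
open Classical in
theorem card_isAdmissible (hex : ∀ S : Finset ι, S.Nonempty → ∃ x ∈ S, ∀ j ∈ S, ∀ i,
      prec i x → prec i j) (S : Finset ι) :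
    ((orderings S).filter (IsAdmissible y prec)).card =
      ∑ P ∈ setPartitions S with ∀ Y ∈ P, IsBalanced y prec Y, cycleWeight P := by
  -- Unbalanced parts are given weight 0, which makes the sum one of products over parts, as
  -- `sum_setPartitions_rec` requires.
  have h : ∀ S : Finset ι,
      ∑ P ∈ setPartitions S with ∀ Y ∈ P, IsBalanced y prec Y, cycleWeight P =
      ∑ P ∈ setPartitions S,
        ∏ Y ∈ P, if IsBalanced y prec Y then (Y.card - 1).factorial else 0 := by
    intro S
    rw [Finset.sum_filter]
    refine Finset.sum_congr rfl fun P _ => ?_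
    split_ifs with hP
    · exact Finset.prod_congr rfl fun Y hY => (if_pos (hP Y hY)).symm
    · push Not at hP
      obtain ⟨Y, hY, hb⟩ := hP
      exact (Finset.prod_eq_zero hY (if_neg hb)).symm
  induction hn : S.card using Nat.strong_induction_on generalizing S with
  | _ n ih =>
  rcases S.eq_empty_or_nonempty with rfl | hS
  · rw [h, setPartitions_empty, Finset.sum_singleton, Finset.prod_empty]
    have : orderings (∅ : Finset ι) = {[]} := by
      ext L
      rw [mem_orderings, Finset.mem_singleton]
      simp [List.eq_nil_iff_forall_not_mem]
      rintro h
      exact (List.eq_nil_iff_forall_not_mem.2 h) ▸ List.nodup_nil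
    rw [this, Finset.filter_true_of_mem]
    · simp
    · simp [IsAdmissible]
  · obtain ⟨x, hxS, hx⟩ := hex S hS
    rw [card_isAdmissible_rec hxS hx, h, sum_setPartitions_rec _ hxS, ← Finset.filter_filter,
      Finset.sum_filter (p := fun Y => IsBalanced y prec Y)]
    refine Finset.sum_congr rfl fun Y hY => ?_
    rw [Finset.mem_filter, Finset.mem_powerset] at hY
    split_ifs
    · rw [← h, ← ih _ _ (S \ Y) rfl]
      rw [← hn]
      exact Finset.card_lt_card (Finset.sdiff_ssubset hY.1 ⟨x, hY.2⟩)
    · rw [zero_mul]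

theorem sum_powerset_mem {R : Type*} [AddCommMonoid R] {S : Finset ι} {x : ι} (hx : x ∈ S)
    (f : ℕ → R) :
    ∑ Y ∈ S.powerset with x ∈ Y, f Y.card =
      ∑ k ∈ Finset.range S.card, (S.card - 1).choose k • f (k + 1) := by
  have h : ∑ Y ∈ S.powerset with x ∈ Y, f Y.card =
      ∑ Y ∈ (S.erase x).powerset, f (Y.card + 1) := by
    refine Finset.sum_nbij' (fun Y => Y.erase x) (fun Y => insert x Y) ?_ ?_ ?_ ?_ ?_
    · intro Y hY
      rw [Finset.mem_filter, Finset.mem_powerset] at hY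
      exact Finset.mem_powerset.2 (Finset.erase_subset_erase x hY.1)
    · intro Y hY
      rw [Finset.mem_powerset] at hY
      rw [Finset.mem_filter, Finset.mem_powerset]
      exact ⟨Finset.insert_subset hx (hY.trans (Finset.erase_subset _ _)),
        Finset.mem_insert_self _ _⟩
    · intro Y hY
      rw [Finset.mem_filter] at hY
      exact Finset.insert_erase hY.2
    · intro Y hY
      rw [Finset.mem_powerset] at hY
      exact Finset.erase_insert fun h => by simpa using hY h
    · intro Y hY
      rw [Finset.mem_filter] at hY
      rw [Finset.card_erase_add_one hY.2]
  have hc : S.card - 1 + 1 = S.card := Nat.sub_add_cancel (Finset.card_pos.2 ⟨x, hx⟩)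
  rw [h, Finset.sum_powerset_apply_card (fun k => f (k + 1)), Finset.card_erase_of_mem hx, hc]

/-- The exponential formula for sums over set partitions weighted by numbers of permutations. -/
theorem sum_cycleWeight_mul_prod {R : Type*} [CommSemiring R] (z h : ℕ → R) (h0 : h 0 = 1)
    (hrec : ∀ n : ℕ, ((n : R) + 1) * h (n + 1) = ∑ k ∈ Finset.range (n + 1), z (k + 1) * h (n - k))
    (S : Finset ι) :
    ∑ P ∈ setPartitions S, (cycleWeight P : R) * ∏ Y ∈ P, z Y.card =
      S.card.factorial * h S.card := by
  have hw : ∀ S : Finset ι, ∑ P ∈ setPartitions S, (cycleWeight P : R) * ∏ Y ∈ P, z Y.card =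
      ∑ P ∈ setPartitions S, ∏ Y ∈ P, ((Y.card - 1).factorial * z Y.card) := by
    intro S
    refine Finset.sum_congr rfl fun P _ => ?_
    rw [cycleWeight, Nat.cast_prod, Finset.prod_mul_distrib]
  induction hn : S.card using Nat.strong_induction_on generalizing S with
  | _ n ih =>
  rcases S.eq_empty_or_nonempty with rfl | ⟨x, hx⟩
  · subst hn
    simp [setPartitions_empty, h0, cycleWeight]
  · rw [hw, sum_setPartitions_rec _ hx]
    have h1 : ∀ Y ∈ S.powerset.filter fun Y => x ∈ Y,
        ((Y.card - 1).factorial * z Y.card) *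
          ∑ Q ∈ setPartitions (S \ Y), ∏ Z ∈ Q, ((Z.card - 1).factorial * z Z.card) =
        ((Y.card - 1).factorial * z Y.card) * ((n - Y.card).factorial * h (n - Y.card)) := by
      intro Y hY
      rw [Finset.mem_filter, Finset.mem_powerset] at hY
      rw [← hw, ih (n - Y.card) _ (S \ Y)]
      · rw [Finset.card_sdiff_of_subset hY.1, hn]
      · have := Finset.card_pos.2 ⟨x, hY.2⟩
        have := Finset.card_le_card hY.1
        omega
    rw [Finset.sum_congr rfl h1, sum_powerset_mem hx fun k =>
      (((k - 1).factorial * z k) * ((n - k).factorial * h (n - k)) : R), hn]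
    obtain ⟨m, rfl⟩ : ∃ m, n = m + 1 := ⟨n - 1, by
      have := Finset.card_pos.2 ⟨x, hx⟩
      omega⟩
    rw [Nat.factorial_succ, Nat.cast_mul, mul_comm ((m + 1 : ℕ) : R), mul_assoc, Nat.cast_succ,
      hrec, Finset.mul_sum]
    refine Finset.sum_congr rfl fun k hk => ?_
    have hk' : k ≤ m := by
      have := Finset.mem_range.1 hk
      omega
    -- The part containing `x` has size `k + 1`: there are `m.choose k` choices for it, weight `k!`,
    -- and `(m - k)!` comes from the rest. The product `m!` does not depend on `k`.
    rw [← Nat.choose_mul_factorial_mul_factorial hk', nsmul_eq_mul]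
    simp only [Nat.add_sub_cancel, Nat.add_sub_add_right]
    push_cast
    ring

end SetPartitions

/-! ### Rank functions along a chain of sets -/

section Flags

set_option linter.unusedSectionVars false

variable {ι β : Type*} [Fintype ι] [Fintype β] [DecidableEq ι]

/-- The elements of `A` in the blocks satisfying `q`. -/
def inBlocks (A : Set (ι × β)) (q : ι → Prop) : Set (ι × β) := {e | e ∈ A ∧ q e.1}

theorem mem_inBlocks {A : Set (ι × β)} {q : ι → Prop} {e : ι × β} :
    e ∈ inBlocks A q ↔ e ∈ A ∧ q e.1 := Iff.rfl

theorem inBlocks_mono {A B : Set (ι × β)} (h : A ⊆ B) (q : ι → Prop) :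
    inBlocks A q ⊆ inBlocks B q := fun _ he => ⟨h he.1, he.2⟩

/-- The excess of `B` over the capacity `b` in the block `i`. -/
noncomputable def excess (b : ℕ) (B : Set (ι × β)) (i : ι) : ℤ :=
  (inBlocks B (· = i)).ncard - b

/-- All elements of `B` in the block `i` precede all elements outside `B` in the block `j`. -/
def Precedes (pos : ι × β → ℕ) (B : Set (ι × β)) (i j : ι) : Prop :=
  ∀ f ∈ B, f.1 = i → ∀ e ∉ B, e.1 = j → pos f < pos e

/-- Initial segments for the order given by `pos`. -/
def IsInitial (pos : ι × β → ℕ) (A : Set (ι × β)) : Prop :=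
  ∀ e ∈ A, ∀ f, pos f < pos e → f ∈ A

theorem ncard_inBlocks_finset (B : Set (ι × β)) (Y : Finset ι) :
    (inBlocks B (· ∈ Y)).ncard = ∑ i ∈ Y, (inBlocks B (· = i)).ncard := by
  classical
  simp only [Set.ncard_eq_toFinset_card']
  rw [Finset.card_eq_sum_card_fiberwise (f := Prod.fst) (t := Y)]
  · refine Finset.sum_congr rfl fun i hi => ?_
    congr 1
    ext e
    simp only [Finset.mem_filter, Set.mem_toFinset, mem_inBlocks]
    constructor
    · exact fun h => ⟨h.1.1, h.2⟩
    · exact fun h => ⟨⟨h.1, h.2 ▸ hi⟩, h.2⟩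
  · intro e he
    rw [Set.coe_toFinset, mem_inBlocks] at he
    exact he.2

theorem sum_excess (b : ℕ) (B : Set (ι × β)) (Y : Finset ι) :
    ∑ i ∈ Y, excess b B i = (inBlocks B (· ∈ Y)).ncard - b * Y.card := by
  simp only [excess]
  rw [Finset.sum_sub_distrib, ncard_inBlocks_finset, Finset.sum_const]
  push_cast
  ring

theorem sum_map_excess (b : ℕ) (B : Set (ι × β)) {T : List ι} (hT : T.Nodup) :
    (T.map (excess b B)).sum = (inBlocks B (· ∈ T)).ncard - b * T.length := by
  rw [← List.sum_toFinset _ hT, sum_excess, List.toFinset_card_of_nodup hT]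
  simp only [List.mem_toFinset]

/-- `x` is the block holding the earliest element outside `B`: whatever precedes that element
precedes all elements outside `B` in `S`. If there are none, the condition is vacuous. -/
theorem exists_precedes_min (pos : ι × β → ℕ) (B : Set (ι × β)) (S : Finset ι)
    (hS : S.Nonempty) : ∃ x ∈ S, ∀ j ∈ S, ∀ i, Precedes pos B i x → Precedes pos B i j := by
  by_cases h : ∃ e, e ∉ B ∧ e.1 ∈ S
  · obtain ⟨e, he, hmin⟩ := Set.exists_min_image {e : ι × β | e ∉ B ∧ e.1 ∈ S} pos
      (Set.toFinite _) h
    refine ⟨e.1, he.2, fun j hj i hi f hf hfi e' he' hej => ?_⟩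
    exact (hi f hf hfi e he.1 rfl).trans_le (hmin e' ⟨he', hej ▸ hj⟩)
  · push Not at h
    obtain ⟨x, hx⟩ := hS
    exact ⟨x, hx, fun j hj i _ f _ _ e he hej => absurd (hej ▸ hj) (h e he)⟩

theorem IsInitial.subset_of_precedes {pos : ι × β → ℕ} {A B : Set (ι × β)} (hA : IsInitial pos A)
    {q : ι → Prop} {e : ι × β} (heA : e ∈ A) (heB : e ∉ B)
    (h : ∀ i, q i → Precedes pos B i e.1) : inBlocks B q ⊆ A := fun f hf =>
  hA e heA f (h f.1 hf.2 f hf.1 rfl e heB rfl)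

/-- An admissible `B` acts as the greedy basis of the nested matroid. Nonpositive prefix weights
make `A ∩ B` independent, which bounds the rank below; a prefix of weight zero covering `A \ B`
gives the bound above. Only these independence and rank bounds on `r` are used. -/
theorem rank_eq_of_isAdmissible {pos : ι × β → ℕ} {b : ℕ} {B : Set (ι × β)} {L : List ι}
    (hL : L ∈ orderings Finset.univ) (h : IsAdmissible (excess b B) (Precedes pos B) L)
    {r : Set (ι × β) → ℕ}
    (hindep : ∀ I, (∀ T, T <+: L → (inBlocks I (· ∈ T)).ncard ≤ b * T.length) → I.ncard ≤ r I)
    (hmono : Monotone r)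
    (hle : ∀ A, ∀ T, T <+: L → r A ≤ (inBlocks A (· ∉ T)).ncard + b * T.length)
    {A : Set (ι × β)} (hA : IsInitial pos A) : r A = (A ∩ B).ncard := by
  obtain ⟨hnodup, hmem⟩ := mem_orderings.1 hL
  have hcap : ∀ T, T <+: L → (T.map (excess b B)).sum =
      (inBlocks B (· ∈ T)).ncard - b * T.length := fun T hT =>
    sum_map_excess b B (hT.sublist.nodup hnodup)
  refine le_antisymm ?_ ?_
  · by_cases hAB : (A \ B).Nonempty
    · choose! T hT hiT hT0 hprec using h.2.2
      have hall : ∀ i, i ∈ L := fun i => (hmem i).2 (Finset.mem_univ i)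
      -- Prefixes are nested, so the longest of the prefixes attached to elements of `A \ B` covers
      -- all of `A \ B`. As `A` is initial and contains `e`, it contains all of `B` in those blocks.
      obtain ⟨e, he, hmax⟩ := Set.exists_max_image (A \ B) (fun e => (T e.1).length)
        (Set.toFinite _) hAB
      have hsub : A \ B ⊆ {e' | e'.1 ∈ T e.1} := fun e' he' =>
        (List.prefix_of_prefix_length_le (hT _ (hall e'.1)) (hT _ (hall e.1))
          (hmax e' he')).subset (hiT _ (hall e'.1))
      have hBA := hA.subset_of_precedes (q := (· ∈ T e.1)) he.1 he.2 (hprec e.1 (hall e.1))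
      have h1 := hle A _ (hT _ (hall e.1))
      have h2 := hcap _ (hT _ (hall e.1))
      rw [hT0 _ (hall e.1)] at h2
      have h3 : (A ∩ B).ncard = (inBlocks A (· ∉ T e.1)).ncard +
          (inBlocks B (· ∈ T e.1)).ncard := by
        rw [← Set.ncard_union_eq]
        · congr 1
          ext f
          constructor
          · rintro ⟨hfA, hfB⟩
            by_cases hf : f.1 ∈ T e.1
            · exact Or.inr ⟨hfB, hf⟩
            · exact Or.inl ⟨hfA, hf⟩
          · rintro (hf | hf)
            · refine ⟨hf.1, ?_⟩
              by_contra hfB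
              exact hf.2 (hsub ⟨hf.1, hfB⟩)
            · exact ⟨hBA hf, hf.1⟩
        · exact Set.disjoint_left.2 fun f hf hf' => hf.2 hf'.2
      zify at h1 h3 ⊢
      linarith
    · rw [Set.not_nonempty_iff_eq_empty, Set.sdiff_eq_empty] at hAB
      have := hle A [] List.nil_prefix
      rw [Set.inter_eq_left.2 hAB]
      simpa [inBlocks] using this
  · refine (hindep _ fun T hT => ?_).trans (hmono Set.inter_subset_left)
    have h1 := Set.ncard_le_ncard (inBlocks_mono (Set.inter_subset_right (s := A) (t := B)) (· ∈ T))
    have h2 := h.2.1 T hT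
    rw [hcap T hT] at h2
    zify at h1 ⊢
    linarith

theorem sum_sum_setPartitions {R : Type*} [AddCommMonoid R] {S : Finset ι}
    {P : Finset (Finset ι)} (hP : P ∈ setPartitions S) (f : ι → R) :
    ∑ Y ∈ P, ∑ i ∈ Y, f i = ∑ i ∈ S, f i := by
  have h : S = P.biUnion id := by
    ext i
    rw [Finset.mem_biUnion]
    constructor
    · intro hi
      obtain ⟨Y, hY, -⟩ := (mem_setPartitions.1 hP).2.2 i hi
      exact ⟨Y, hY⟩
    · rintro ⟨Y, hY, hi⟩
      exact (mem_setPartitions.1 hP).1 Y hY hi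
  rw [h, Finset.sum_biUnion]
  · rfl
  · intro Y hY Z hZ hne
    exact Finset.disjoint_left.2 fun i hiY hiZ => hne (eq_of_mem_setPartitions hP hY hZ hiY hiZ)

/-- The rank function of the direct sum of the uniform matroids of rank `b |Y|` on the unions of
the blocks in `Y`, for the parts `Y` of `P`. -/
noncomputable def partitionRank (b : ℕ) (P : Finset (Finset ι)) (A : Set (ι × β)) : ℕ :=
  ∑ Y ∈ P, min (inBlocks A (· ∈ Y)).ncard (b * Y.card)

/-- Within a balanced part, the elements of `B` come first and number `b * Y.card`. An initial
segment therefore either stays inside `B` there or contains all of it, which are the two cases of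
the minimum. -/
theorem partitionRank_eq_of_isBalanced {pos : ι × β → ℕ} {b : ℕ} {B : Set (ι × β)}
    {P : Finset (Finset ι)} (hP : P ∈ setPartitions Finset.univ)
    (h : ∀ Y ∈ P, IsBalanced (excess b B) (Precedes pos B) Y)
    {A : Set (ι × β)} (hA : IsInitial pos A) : partitionRank b P A = (A ∩ B).ncard := by
  have hsum : (A ∩ B).ncard = ∑ Y ∈ P, (inBlocks (A ∩ B) (· ∈ Y)).ncard := by
    simp only [ncard_inBlocks_finset]
    rw [sum_sum_setPartitions hP, ← ncard_inBlocks_finset]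
    simp [inBlocks]
  rw [partitionRank, hsum]
  refine Finset.sum_congr rfl fun Y hY => ?_
  obtain ⟨h1, h2⟩ := h Y hY
  rw [sum_excess] at h1
  have hcap : (inBlocks B (· ∈ Y)).ncard = b * Y.card := by
    zify
    linarith
  rw [← hcap]
  by_cases hex : ∃ e ∈ inBlocks A (· ∈ Y), e ∉ B
  · obtain ⟨e, ⟨heA, heY⟩, heB⟩ := hex
    have hBA := hA.subset_of_precedes (q := (· ∈ Y)) heA heB fun i hi => h2 i hi e.1 heY
    have hsub : inBlocks B (· ∈ Y) ⊆ inBlocks A (· ∈ Y) := fun f hf => ⟨hBA hf, hf.2⟩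
    rw [min_eq_right (Set.ncard_le_ncard hsub)]
    congr 1
    ext f
    exact ⟨fun hf => ⟨⟨hBA hf, hf.1⟩, hf.2⟩, fun hf => ⟨hf.1.2, hf.2⟩⟩
  · push Not at hex
    have hsub : inBlocks A (· ∈ Y) ⊆ inBlocks B (· ∈ Y) := fun f hf => ⟨hex f hf, hf.2⟩
    rw [min_eq_left (Set.ncard_le_ncard hsub)]
    congr 1
    ext f
    exact ⟨fun hf => ⟨⟨hf.1, hex f hf⟩, hf.2⟩, fun hf => ⟨hf.1.1, hf.2⟩⟩

theorem card_filter_card_lt {α : Type*} {pos : α → ℕ} (hpos : pos.Injective)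
    (Z : Finset α) {k : ℕ} (hk : k ≤ Z.card) :
    (Z.filter fun e => (Z.filter fun f => pos f < pos e).card < k).card = k := by
  set g : α → ℕ := fun e => (Z.filter fun f => pos f < pos e).card with hg
  have hlt : ∀ e ∈ Z, ∀ f, pos e < pos f → g e < g f := fun e he f hef => by
    refine Finset.card_lt_card (Finset.ssubset_iff_of_subset ?_ |>.2 ⟨e, ?_, ?_⟩)
    · intro x hx
      rw [Finset.mem_filter] at hx ⊢
      exact ⟨hx.1, hx.2.trans hef⟩
    · exact Finset.mem_filter.2 ⟨he, hef⟩
    · exact fun h => lt_irrefl _ (Finset.mem_filter.1 h).2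
  have hinj : Set.InjOn g Z := fun e he f hf hef => by
    by_contra hne
    rcases lt_or_gt_of_ne (fun h => hne (hpos h) : pos e ≠ pos f) with h | h
    · exact (hlt e he f h).ne hef
    · exact (hlt f hf e h).ne hef.symm
  have himg : Z.image g = Finset.range Z.card := by
    refine Finset.eq_of_subset_of_card_le (fun m hm => ?_) ?_
    · obtain ⟨e, he, rfl⟩ := Finset.mem_image.1 hm
      refine Finset.mem_range.2 (Finset.card_lt_card (Finset.filter_ssubset.2 ⟨e, he, ?_⟩))
      exact lt_irrefl _
    · rw [Finset.card_image_of_injOn hinj, Finset.card_range]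
  have h1 : (Z.filter fun e => g e < k).card = ((Z.image g).filter (· < k)).card := by
    rw [Finset.filter_image, Finset.card_image_of_injOn]
    exact hinj.mono (Finset.coe_subset.2 (Finset.filter_subset _ _))
  rw [h1, himg]
  have h2 : (Finset.range Z.card).filter (· < k) = Finset.range k := by
    ext m
    rw [Finset.mem_filter, Finset.mem_range, Finset.mem_range]
    omega
  rw [h2, Finset.card_range]

/-- The greedy basis takes the first `b * Y.card` elements of each part; the bound on `b` ensures
that there are that many. -/
theorem exists_isBalanced {pos : ι × β → ℕ} (hpos : pos.Injective) {b : ℕ}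
    (hb : b ≤ Fintype.card β) {P : Finset (Finset ι)} (hP : P ∈ setPartitions Finset.univ) :
    ∃ B : Set (ι × β), ∀ Y ∈ P, IsBalanced (excess b B) (Precedes pos B) Y := by
  classical
  set Z : Finset ι → Finset (ι × β) := fun Y => Y ×ˢ Finset.univ with hZ
  have hmemZ : ∀ Y (e : ι × β), e ∈ Z Y ↔ e.1 ∈ Y := fun Y e => by
    rw [hZ, Finset.mem_product]
    simp
  refine ⟨{e | ∃ Y ∈ P, e.1 ∈ Y ∧ ((Z Y).filter fun f => pos f < pos e).card < b * Y.card},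
    fun Y hY => ⟨?_, ?_⟩⟩
  · have h1 : inBlocks {e | ∃ Y ∈ P, e.1 ∈ Y ∧
        ((Z Y).filter fun f => pos f < pos e).card < b * Y.card} (· ∈ Y) =
        ((Z Y).filter fun e => ((Z Y).filter fun f => pos f < pos e).card < b * Y.card :
          Finset (ι × β)) := by
      ext e
      simp only [mem_inBlocks, Set.mem_ofPred_eq, Finset.coe_filter, hmemZ]
      constructor
      · rintro ⟨⟨Y', hY', heY', hlt⟩, heY⟩
        obtain rfl := eq_of_mem_setPartitions hP hY hY' heY heY'
        exact ⟨heY, hlt⟩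
      · exact fun h => ⟨⟨Y, hY, h⟩, h.1⟩
    rw [sum_excess, h1, Set.ncard_coe_finset, card_filter_card_lt hpos]
    · push_cast
      ring
    · rw [hZ, Finset.card_product, Finset.card_univ, mul_comm]
      exact Nat.mul_le_mul_left _ hb
  · rintro i hi j hj f ⟨Y', hY', hfY', hf⟩ rfl e he rfl
    obtain rfl := eq_of_mem_setPartitions hP hY hY' hi hfY'
    by_contra! hlt
    refine he ⟨Y, hY, hj, (Finset.card_le_card fun g hg => ?_).trans_lt hf⟩
    rw [Finset.mem_filter] at hg ⊢
    exact ⟨hg.1, hg.2.trans_le hlt⟩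

/-- An element lies in `B` exactly when the count jumps as the initial segment passes it. -/
theorem eq_of_ncard_inter_eq {pos : ι × β → ℕ} (hpos : pos.Injective) {B B' : Set (ι × β)}
    (h : ∀ A, IsInitial pos A → (A ∩ B).ncard = (A ∩ B').ncard) : B = B' := by
  have hins : ∀ (B : Set (ι × β)) (e : ι × β), e ∈ B ↔
      ({f | pos f < pos e} ∩ B).ncard < ({f | pos f ≤ pos e} ∩ B).ncard := by
    intro B e
    constructor
    · intro he
      refine Set.ncard_lt_ncard ⟨fun f hf => ⟨le_of_lt (show pos f < pos e from hf.1), hf.2⟩,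
        fun hsub => ?_⟩
      have h1 : e ∈ {f | pos f ≤ pos e} ∩ B := ⟨le_refl (pos e), he⟩
      exact lt_irrefl (pos e) (hsub h1).1
    · intro hlt
      by_contra he
      have hsub : {f | pos f ≤ pos e} ∩ B ⊆ {f | pos f < pos e} ∩ B := fun f hf =>
        ⟨lt_of_le_of_ne (show pos f ≤ pos e from hf.1) fun hfe =>
          he ((hpos hfe : f = e) ▸ hf.2), hf.2⟩
      exact absurd (Set.ncard_le_ncard hsub) hlt.not_ge
  ext e
  have h1 : IsInitial pos {f | pos f < pos e} := fun x hx f hf => lt_trans hf hx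
  have h2 : IsInitial pos {f | pos f ≤ pos e} := fun x hx f hf => hf.le.trans hx
  rw [hins B, hins B', h _ h1, h _ h2]

/-- Sort by the number of members of the chain that miss the element, and break ties by an arbitrary
enumeration, encoded as the remainder modulo the cardinality. -/
theorem exists_pos_of_isChain {α : Type*} [Fintype α] (𝒞 : Set (Set α))
    (h𝒞 : IsChain (· ⊆ ·) 𝒞) :
    ∃ pos : α → ℕ, pos.Injective ∧ ∀ A ∈ 𝒞, ∀ e ∈ A, ∀ f, pos f < pos e → f ∈ A := by
  classical
  set key : α → ℕ := fun e => {A | A ∈ 𝒞 ∧ e ∉ A}.ncard with hkey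
  let idx := Fintype.equivFin α
  have hidx : ∀ e, (idx e : ℕ) < Fintype.card α := fun e => (idx e).2
  refine ⟨fun e => key e * Fintype.card α + idx e, fun e f hef => ?_, fun A hA e he f hf => ?_⟩
  · have h1 := congrArg (· % Fintype.card α) hef
    simp only [Nat.mul_add_mod_self_right, Nat.mod_eq_of_lt (hidx _)] at h1
    exact idx.injective (Fin.ext h1)
  · by_contra hfA
    have hlt : key e < key f := by
      refine Set.ncard_lt_ncard ⟨fun C hC => ⟨hC.1, fun hfC => ?_⟩, fun hsub => ?_⟩
      · rcases h𝒞.total hA hC.1 with h | h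
        · exact hC.2 (h he)
        · exact hfA (h hfC)
      · exact (hsub ⟨hA, hfA⟩ : A ∈ 𝒞 ∧ e ∉ A).2 he
    have h2 : (key e + 1) * Fintype.card α ≤ key f * Fintype.card α := Nat.mul_le_mul_right _ hlt
    have h3 := hidx e
    simp only at hf
    rw [Nat.add_mul] at h2
    omega

theorem sum_cycleWeight (S : Finset ι) :
    ∑ P ∈ setPartitions S, cycleWeight P = S.card.factorial := by
  have h := sum_cycleWeight_mul_prod (R := ℕ) (fun _ => 1) (fun _ => 1) rfl (by simp) S
  simpa only [Finset.prod_const_one, mul_one, Nat.cast_id] using h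

open Classical in
/-- Double counting: if each `B` is related to equally many elements of `s` and of `t`, and each
element of `t` is related to exactly one `B` and each element of `s` to at most one, then sums over
`s` and `t` of functions that factor through `B` agree. -/
theorem sum_eq_sum_of_card_fiber_eq {σ τ κ : Type*} [Fintype κ] {s : Finset σ} {t : Finset τ}
    {w : τ → ℕ} {adm : σ → κ → Prop} {bal : τ → κ → Prop}
    (hcount : ∀ B, (s.filter fun L => adm L B).card = ∑ P ∈ t with bal P B, w P)
    (hsub : ∀ L ∈ s, ∀ B B', adm L B → adm L B' → B = B')
    (huniq : ∀ P ∈ t, ∃! B, bal P B) (htotal : ∑ P ∈ t, w P = s.card)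
    {F : σ → ℤ} {G : τ → ℤ} {Ψ : κ → ℤ} (hF : ∀ L ∈ s, ∀ B, adm L B → F L = Ψ B)
    (hG : ∀ P ∈ t, ∀ B, bal P B → G P = Ψ B) :
    ∑ L ∈ s, F L = ∑ P ∈ t, (w P : ℤ) * G P := by
  have huniq' : ∀ P ∈ t, (Finset.univ.filter fun B => bal P B).card = 1 := by
    intro P hP
    obtain ⟨B, hB, hu⟩ := huniq P hP
    rw [Finset.card_eq_one]
    exact ⟨B, Finset.eq_singleton_iff_unique_mem.2
      ⟨by simpa using hB, fun B' hB' => hu B' (Finset.mem_filter.1 hB').2⟩⟩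
  have hle : ∀ L ∈ s, (Finset.univ.filter fun B => adm L B).card ≤ 1 := fun L hL =>
    Finset.card_le_one.2 fun B hB B' hB' =>
      hsub L hL B B' (Finset.mem_filter.1 hB).2 (Finset.mem_filter.1 hB').2
  -- Existence of a `B` for each `L` comes from counting: the fibres have at most one element each
  -- and their sizes add up to the total weight of `t`, which is `s.card`, so each has exactly one.
  have hall : ∑ L ∈ s, (Finset.univ.filter fun B => adm L B).card = ∑ _L ∈ s, 1 := by
    have h1 : ∑ L ∈ s, (Finset.univ.filter fun B => adm L B).card =
        ∑ B, (s.filter fun L => adm L B).card := by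
      simp only [Finset.card_filter]
      exact Finset.sum_comm
    rw [h1]
    simp only [hcount, Finset.sum_filter]
    rw [Finset.sum_comm, ← Finset.card_eq_sum_ones, ← htotal]
    refine Finset.sum_congr rfl fun P hP => ?_
    rw [← Finset.sum_filter, Finset.sum_const, huniq' P hP, one_smul]
  have hone := (Finset.sum_eq_sum_iff_of_le hle).1 hall
  have hFL : ∀ L ∈ s, F L = ∑ B, if adm L B then Ψ B else 0 := by
    intro L hL
    rw [← Finset.sum_filter, ← one_smul ℕ (F L), ← hone L hL, ← Finset.sum_const]
    exact Finset.sum_congr rfl fun B hB => hF L hL B (Finset.mem_filter.1 hB).2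
  have hGP : ∀ P ∈ t, (w P : ℤ) * G P = ∑ B, if bal P B then (w P : ℤ) * Ψ B else 0 := by
    intro P hP
    rw [← Finset.sum_filter, ← one_smul ℕ ((w P : ℤ) * G P), ← huniq' P hP, ← Finset.sum_const]
    exact Finset.sum_congr rfl fun B hB => by rw [hG P hP B (Finset.mem_filter.1 hB).2]
  rw [Finset.sum_congr rfl hFL, Finset.sum_congr rfl hGP, Finset.sum_comm,
    Finset.sum_comm (s := t)]
  refine Finset.sum_congr rfl fun B _ => ?_
  rw [← Finset.sum_filter, Finset.sum_const, hcount, nsmul_eq_mul, Nat.cast_sum, Finset.sum_mul,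
    Finset.sum_filter]

/-- On each chain of sets, the rank functions of the nested matroids over all orderings of the
blocks have the same joint distribution as the rank functions of the sums of uniform matroids
over all partitions of the set of blocks. -/
theorem sum_orderings_eq_sum_setPartitions {b : ℕ} (hb : b ≤ Fintype.card β)
    {r : List ι → Set (ι × β) → ℕ}
    (hindep : ∀ L ∈ orderings Finset.univ, ∀ I,
      (∀ T, T <+: L → (inBlocks I (· ∈ T)).ncard ≤ b * T.length) → I.ncard ≤ r L I)
    (hmono : ∀ L ∈ orderings Finset.univ, Monotone (r L))
    (hle : ∀ L ∈ orderings Finset.univ, ∀ A, ∀ T, T <+: L →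
      r L A ≤ (inBlocks A (· ∉ T)).ncard + b * T.length)
    (𝒞 : Set (Set (ι × β))) (h𝒞 : IsChain (· ⊆ ·) 𝒞) (Φ : (Set (ι × β) → ℕ) → ℤ)
    (hΦ : DependsOn Φ 𝒞) :
    ∑ L ∈ orderings Finset.univ, Φ (r L) =
      ∑ P ∈ setPartitions Finset.univ, (cycleWeight P : ℤ) * Φ (partitionRank b P) := by
  obtain ⟨pos, hpos, hini⟩ := exists_pos_of_isChain 𝒞 h𝒞
  have hr : ∀ L ∈ orderings (Finset.univ : Finset ι), ∀ B : Set (ι × β),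
      IsAdmissible (excess b B) (Precedes pos B) L → ∀ A, IsInitial pos A →
      r L A = (A ∩ B).ncard := fun L hL B h A hA =>
    rank_eq_of_isAdmissible hL h (hindep L hL) (hmono L hL) (hle L hL) hA
  have hr' : ∀ P ∈ setPartitions (Finset.univ : Finset ι), ∀ B : Set (ι × β),
      (∀ Y ∈ P, IsBalanced (excess b B) (Precedes pos B) Y) → ∀ A,
      IsInitial pos A → partitionRank b P A = (A ∩ B).ncard := fun P hP B h A hA =>
    partitionRank_eq_of_isBalanced hP h hA
  refine sum_eq_sum_of_card_fiber_eq (κ := Set (ι × β))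
    (adm := fun L B => IsAdmissible (excess b B) (Precedes pos B) L)
    (bal := fun P B => ∀ Y ∈ P, IsBalanced (excess b B) (Precedes pos B) Y)
    (Ψ := fun B => Φ fun A => (A ∩ B).ncard)
    (fun B => ?_) ?_ ?_ ?_ ?_ ?_
  · convert card_isAdmissible (y := excess b B) (exists_precedes_min pos B) Finset.univ
  · intro L hL B B' h h'
    exact eq_of_ncard_inter_eq hpos fun A hA => by rw [← hr L hL B h A hA, ← hr L hL B' h' A hA]
  · intro P hP
    obtain ⟨B, hB⟩ := exists_isBalanced hpos hb hP
    exact ⟨B, hB, fun B' hB' => eq_of_ncard_inter_eq hpos fun A hA => by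
      rw [← hr' P hP B hB A hA, ← hr' P hP B' hB' A hA]⟩
  · rw [sum_cycleWeight, card_orderings]
  · exact fun L hL B h => hΦ fun A hA => hr L hL B h A (hini A hA)
  · exact fun P hP B h => hΦ fun A hA => hr' P hP B h A (hini A hA)

end Flags

/-! ### Sums over integer partitions -/

section Partitions

theorem zFactor_eq_prod {n N : ℕ} (h : n ≤ N) (lam : n.Partition) :
    zFactor lam =
      ∏ i ∈ Finset.Icc 1 N, i ^ lam.parts.count i * (lam.parts.count i).factorial := by
  rw [zFactor]
  refine Finset.prod_subset (Finset.Icc_subset_Icc_right h) fun i hi hi' => ?_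
  rw [Finset.mem_Icc] at hi hi'
  rw [Multiset.count_eq_zero.2 fun hmem => hi' ⟨hi.1, Nat.Partition.le_of_mem_parts hmem⟩]
  simp

theorem zFactor_ne_zero {n : ℕ} (lam : n.Partition) : zFactor lam ≠ 0 := by
  rw [zFactor, Finset.prod_ne_zero_iff]
  intro i hi
  rw [Finset.mem_Icc] at hi
  exact mul_ne_zero (pow_ne_zero _ (by omega)) (Nat.factorial_ne_zero _)

/-- Adding a part `k + 1` to a partition of `n - k`. -/
def consPart {n k : ℕ} (hk : k ≤ n) (mu : (n - k).Partition) : (n + 1).Partition where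
  parts := (k + 1) ::ₘ mu.parts
  parts_pos := by
    intro i hi
    rcases Multiset.mem_cons.1 hi with rfl | hi
    · exact Nat.succ_pos k
    · exact mu.parts_pos hi
  parts_sum := by
    rw [Multiset.sum_cons, mu.parts_sum]
    omega

/-- Only the factor at `k + 1` changes: its power gains a factor `k + 1`, its factorial gains the
new multiplicity. -/
theorem zFactor_consPart {n k : ℕ} (hk : k ≤ n) (mu : (n - k).Partition) :
    zFactor (consPart hk mu) =
      (k + 1) * (consPart hk mu).parts.count (k + 1) * zFactor mu := by
  have hmem : k + 1 ∈ Finset.Icc 1 (n + 1) := by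
    rw [Finset.mem_Icc]
    omega
  rw [zFactor, zFactor_eq_prod (by omega : n - k ≤ n + 1) mu, ← Finset.mul_prod_erase _ _ hmem,
    ← Finset.mul_prod_erase _ _ hmem]
  have h : ∀ i ∈ (Finset.Icc 1 (n + 1)).erase (k + 1),
      i ^ (consPart hk mu).parts.count i * ((consPart hk mu).parts.count i).factorial =
        i ^ mu.parts.count i * (mu.parts.count i).factorial := by
    intro i hi
    rw [consPart, Multiset.count_cons_of_ne (Finset.ne_of_mem_erase hi)]
  rw [Finset.prod_congr rfl h, consPart, Multiset.count_cons_self, Nat.factorial_succ, pow_succ]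
  ring

theorem sum_mul_count_parts {n : ℕ} (lam : (n + 1).Partition) :
    ∑ k ∈ Finset.range (n + 1), (k + 1) * lam.parts.count (k + 1) = n + 1 := by
  have h1 : ∑ k ∈ Finset.range (n + 1), (k + 1) * lam.parts.count (k + 1) =
      ∑ i ∈ Finset.Ico 1 (n + 2), i * lam.parts.count i := by
    rw [Finset.range_eq_Ico, Finset.sum_Ico_add' (fun i => i * lam.parts.count i)]
  have h2 : ∑ i ∈ lam.parts.toFinset, i * lam.parts.count i =
      ∑ i ∈ Finset.Ico 1 (n + 2), i * lam.parts.count i := by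
    refine Finset.sum_subset (fun i hi => ?_) fun i _ hi => ?_
    · rw [Multiset.mem_toFinset] at hi
      exact Finset.mem_Ico.2 ⟨lam.parts_pos hi,
        Nat.lt_succ_of_le (Nat.Partition.le_of_mem_parts hi)⟩
    · rw [Multiset.mem_toFinset] at hi
      rw [Multiset.count_eq_zero.2 hi, mul_zero]
  have h3 := lam.parts_sum
  rw [Finset.sum_multiset_count] at h3
  simp only [smul_eq_mul, mul_comm] at h1 h2 h3 ⊢
  rw [h1, ← h2, h3]

/-- The complete homogeneous polynomials in terms of the power sums. -/
noncomputable def sumOverPartitions (z : ℕ → ℚ[X]) (n : ℕ) : ℚ[X] :=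
  ∑ lam : n.Partition, C (1 / (zFactor lam : ℚ)) * (lam.parts.map z).prod

theorem sumOverPartitions_zero (z : ℕ → ℚ[X]) : sumOverPartitions z 0 = 1 := by
  rw [sumOverPartitions, Fintype.sum_unique]
  simp [zFactor]

/-- Newton's identity. Write `n + 1` as the sum of the parts of `lam`, grouped by size; the share of
size `k + 1`, divided by `zFactor lam`, is the coefficient of the partition with one such part
removed. Partitions without a part `k + 1` contribute zero. -/
theorem sumOverPartitions_succ (z : ℕ → ℚ[X]) (n : ℕ) :
    ((n : ℚ[X]) + 1) * sumOverPartitions z (n + 1) =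
      ∑ k ∈ Finset.range (n + 1), z (k + 1) * sumOverPartitions z (n - k) := by
  have h1 : ∀ lam : (n + 1).Partition,
      ((n : ℚ[X]) + 1) * (C (1 / (zFactor lam : ℚ)) * (lam.parts.map z).prod) =
      ∑ k ∈ Finset.range (n + 1), C (((k + 1) * lam.parts.count (k + 1) : ℕ) : ℚ) *
        (C (1 / (zFactor lam : ℚ)) * (lam.parts.map z).prod) := by
    intro lam
    rw [← Finset.sum_mul, ← map_sum, ← Nat.cast_sum, sum_mul_count_parts]
    simp
  rw [sumOverPartitions, Finset.mul_sum, Finset.sum_congr rfl fun lam _ => h1 lam, Finset.sum_comm]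
  refine Finset.sum_congr rfl fun k hk => ?_
  have hk' : k ≤ n := Nat.lt_succ_iff.1 (Finset.mem_range.1 hk)
  rw [sumOverPartitions, Finset.mul_sum]
  symm
  have hinj : Function.Injective (consPart hk') := fun mu mu' h => by
    have := congrArg Nat.Partition.parts h
    exact Nat.Partition.ext ((Multiset.cons_inj_right _).1 this)
  refine Finset.sum_of_injOn (consPart hk') hinj.injOn (fun _ _ => Finset.mem_coe.2
    (Finset.mem_univ _)) ?_ ?_
  · intro lam _ hlam
    rw [Multiset.count_eq_zero.2]
    · simp
    · intro hmem
      refine hlam ⟨⟨lam.parts.erase (k + 1), fun hi => lam.parts_pos (Multiset.mem_of_mem_erase hi),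
        ?_⟩, by simp, Nat.Partition.ext (Multiset.cons_erase hmem)⟩
      have := lam.parts_sum
      rw [← Multiset.cons_erase hmem, Multiset.sum_cons] at this
      omega
  · intro mu _
    have hprod : ((consPart hk' mu).parts.map z).prod = z (k + 1) * (mu.parts.map z).prod := by
      rw [consPart, Multiset.map_cons, Multiset.prod_cons]
    have hc : (consPart hk' mu).parts.count (k + 1) ≠ 0 := by
      rw [consPart, Multiset.count_cons_self]
      exact Nat.succ_ne_zero _
    have hq : ((((k + 1) * (consPart hk' mu).parts.count (k + 1) : ℕ) : ℚ)) *
        (1 / (zFactor (consPart hk' mu) : ℚ)) = 1 / (zFactor mu : ℚ) := by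
      have hz : (zFactor mu : ℚ) ≠ 0 := Nat.cast_ne_zero.2 (zFactor_ne_zero mu)
      have hm : (((k + 1) * (consPart hk' mu).parts.count (k + 1) : ℕ) : ℚ) ≠ 0 :=
        Nat.cast_ne_zero.2 (mul_ne_zero (Nat.succ_ne_zero k) hc)
      rw [zFactor_consPart, Nat.cast_mul _ (zFactor mu)]
      field_simp
    rw [hprod, ← mul_assoc (C _) (C _), ← C_mul, hq]
    ring

end Partitions

/-! ### Ranks in uniform and Catalan matroids -/

section Ranks

theorem exists_isBasis_setRk {α : Type*} [Fintype α] (M : Matroid α) (hM : M.E = Set.univ)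
    (A : Set α) : ∃ I, M.Indep I ∧ I ⊆ A ∧ I.ncard = setRk M A := by
  obtain ⟨I, hI⟩ := M.exists_isBasis A (hM ▸ Set.subset_univ A)
  refine ⟨I, hI.indep, hI.subset, ?_⟩
  rw [setRk, ← hI.encard_eq_eRk, Set.ncard]

theorem ncard_le_setRk_of_indep {α : Type*} [Fintype α] {M : Matroid α} {I : Set α}
    (hI : M.Indep I) : I.ncard ≤ setRk M I := by
  rw [setRk, hI.eRk_eq_encard, Set.ncard]

theorem setRk_uniformMatroid (k N : ℕ) (hk : k ≤ N) (A : Set (Fin N)) :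
    setRk (uniformMatroid k N hk) A = min A.ncard k := by
  have hbase : ∀ B, (uniformMatroid k N hk).IsBase B ↔ B.ncard = k := fun _ => Iff.rfl
  refine le_antisymm ?_ ?_
  · obtain ⟨I, hI, hIA, hr⟩ := exists_isBasis_setRk (uniformMatroid k N hk) rfl A
    obtain ⟨B, hB, hIB⟩ := hI.exists_isBase_superset
    rw [← hr]
    exact le_min (Set.ncard_le_ncard hIA) ((hbase B).1 hB ▸ Set.ncard_le_ncard hIB)
  · obtain ⟨J, hJA, hJ⟩ := Set.exists_subset_card_eq (min_le_left A.ncard k)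
    obtain ⟨B, hJB, -, hB⟩ := Set.exists_subsuperset_card_eq (n := k) (Set.subset_univ J)
      (hJ ▸ min_le_right _ _) (by simpa [Set.ncard_univ] using hk)
    have hJi : (uniformMatroid k N hk).Indep J :=
      Matroid.IsBase.indep ((hbase B).2 hB) |>.subset hJB
    rw [← hJ]
    exact (ncard_le_setRk_of_indep hJi).trans (setRk_mono _ hJA)

theorem exists_isKL_uniform {γ : Type*} [Fintype γ] (k a b : ℕ)
    (hγ : Fintype.card γ = k * (a + b)) :
    ∃ p, IsKL (fun A : Set γ => min A.ncard (b * k)) p ∧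
      zeta (fun A : Set γ => min A.ncard (b * k)) p = zPoly (uniformAB k a b) := by
  obtain ⟨e⟩ : Nonempty (γ ≃ Fin (k * (a + b))) := ⟨Fintype.equivFinOfCardEq hγ⟩
  have hr : (fun A : Set γ => min A.ncard (b * k)) =
      fun A => setRk (uniformAB k a b) (e '' A) := by
    funext A
    rw [uniformAB, setRk_uniformMatroid, Set.ncard_image_of_injective _ e.injective, mul_comm]
  have h1 := (isKL_matroid (uniformAB k a b) rfl).comp_equiv e
  have h2 := zeta_comp_equiv (setRk (uniformAB k a b)) (fun A => klPoly (uniformAB k a b ／ A)) e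
  rw [← hr] at h1 h2
  exact ⟨_, h1, h2.trans (zPoly_eq_zeta (uniformAB k a b) rfl).symm⟩

theorem exists_isKL_sum_uniform {κ : Type*} [Fintype κ] {γ : κ → Type*} [∀ i, Fintype (γ i)]
    (k : κ → ℕ) (a b : ℕ) (hγ : ∀ i, Fintype.card (γ i) = k i * (a + b)) :
    ∃ p, IsKL (fun A : Set ((i : κ) × γ i) => ∑ i, min (Sigma.mk i ⁻¹' A).ncard (b * k i)) p ∧
      zeta (fun A : Set ((i : κ) × γ i) => ∑ i, min (Sigma.mk i ⁻¹' A).ncard (b * k i)) p =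
        ∏ i, zPoly (uniformAB (k i) a b) := by
  choose p hp hz using fun i => exists_isKL_uniform (k i) a b (hγ i)
  refine ⟨_, IsKL.sigma hp, ?_⟩
  rw [zeta_sigma (fun i (A : Set (γ i)) => min A.ncard (b * k i)) p]
  exact Finset.prod_congr rfl fun i _ => hz i

theorem exists_isKL_comp_equiv {α β : Type*} [Fintype α] [Fintype β] (e : α ≃ β)
    {r : Set β → ℕ} {z : ℤ[X]} (h : ∃ p, IsKL r p ∧ zeta r p = z) {r' : Set α → ℕ}
    (hr : ∀ A, r' A = r (e '' A)) : ∃ p, IsKL r' p ∧ zeta r' p = z := by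
  obtain ⟨p, hp, rfl⟩ := h
  obtain rfl : r' = fun A => r (e '' A) := funext hr
  exact ⟨_, hp.comp_equiv e, zeta_comp_equiv r p e⟩

theorem bijective_sigma_parts {ι β : Type*} [Fintype ι] [DecidableEq ι]
    {P : Finset (Finset ι)} (hP : P ∈ setPartitions Finset.univ) :
    Function.Bijective (fun x : (Y : P) × {x : ι × β // x.1 ∈ Y.1} => (x.2 : ι × β)) := by
  constructor
  · rintro ⟨⟨Y, hY⟩, x, hx⟩ ⟨⟨Y', hY'⟩, x', hx'⟩ h
    simp only at h
    subst h
    obtain rfl := eq_of_mem_setPartitions hP hY hY' hx hx'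
    rfl
  · intro x
    obtain ⟨Y, ⟨hY, hx⟩, -⟩ := (mem_setPartitions.1 hP).2.2 x.1 (Finset.mem_univ _)
    exact ⟨⟨⟨Y, hY⟩, x, hx⟩, rfl⟩

/-- The parts cut `ι × β` into disjoint pieces, so `partitionRank` is the rank function of a direct
sum of uniform matroids, transported from the disjoint union. -/
theorem exists_isKL_partitionRank {ι β : Type*} [Fintype ι] [Fintype β] [DecidableEq ι]
    {P : Finset (Finset ι)} (hP : P ∈ setPartitions Finset.univ) (a b : ℕ)
    (hβ : Fintype.card β = a + b) :
    ∃ p, IsKL (partitionRank (β := β) b P) p ∧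
      zeta (partitionRank (β := β) b P) p = ∏ Y ∈ P, zPoly (uniformAB Y.card a b) := by
  have hcard : ∀ Y : P, Fintype.card {x : ι × β // x.1 ∈ Y.1} = Y.1.card * (a + b) := fun Y => by
    rw [Fintype.card_subtype, ← hβ, ← Finset.card_univ, ← Finset.card_product]
    congr 1
    ext x
    simp
  rw [← Finset.prod_coe_sort]
  refine exists_isKL_comp_equiv (Equiv.ofBijective _ (bijective_sigma_parts (β := β) hP)).symm
    (exists_isKL_sum_uniform (fun Y : P => Y.1.card) a b hcard) fun A => ?_
  rw [partitionRank, ← Finset.sum_coe_sort]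
  refine Finset.sum_congr rfl fun Y _ => ?_
  congr 1
  rw [← Set.ncard_image_of_injective _ Subtype.val_injective]
  congr 1
  ext x
  rw [Equiv.image_eq_preimage_symm]
  constructor
  · exact fun h => ⟨⟨x, h.2⟩, h.1, rfl⟩
  · rintro ⟨x, h, rfl⟩
    exact ⟨h, x.2⟩

/-! ### Bases and independent sets of the Catalan matroid by counting at block boundaries. -/

/-- The number of elements of `T` below `y`. -/
def countBelow {N : ℕ} (T : Finset (Fin N)) (y : ℕ) : ℕ := (T.filter fun e : Fin N => (e : ℕ) < y).card

theorem countBelow_add_le {N : ℕ} (T : Finset (Fin N)) (y d : ℕ) :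
    countBelow T (y + d) ≤ countBelow T y + d := by
  induction d with
  | zero => exact le_rfl
  | succ d ih =>
    have h : T.filter (fun e : Fin N => (e : ℕ) < y + (d + 1)) ⊆
        T.filter (fun e : Fin N => (e : ℕ) < y + d) ∪ T.filter (fun e : Fin N => (e : ℕ) = y + d) := by
      intro e he
      simp only [Finset.mem_union, Finset.mem_filter] at he ⊢
      rcases lt_or_eq_of_le (Nat.lt_succ_iff.1 he.2) with h | h
      · exact Or.inl ⟨he.1, h⟩
      · exact Or.inr ⟨he.1, h⟩
    have h1 : (T.filter (fun e : Fin N => (e : ℕ) = y + d)).card ≤ 1 := by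
      refine Finset.card_le_one.2 fun e he f hf => Fin.ext ?_
      rw [Finset.mem_filter] at he hf
      rw [he.2, hf.2]
    have h2 := (Finset.card_le_card h).trans (Finset.card_union_le _ _)
    unfold countBelow at *
    omega

theorem countBelow_mono {N : ℕ} (T : Finset (Fin N)) : Monotone (countBelow T) := fun _ _ h =>
  Finset.card_le_card (Finset.monotone_filter_right _ fun _ _ hx => hx.trans_le h)

theorem countBelow_eq_card {N : ℕ} (T : Finset (Fin N)) {y : ℕ} (hy : N ≤ y) :
    countBelow T y = T.card := by
  rw [countBelow, Finset.filter_true_of_mem fun e _ => e.2.trans_le hy]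

theorem count_mod (a b q d : ℕ) (hd : d ≤ a + b) :
    Nat.count (fun i => a ≤ i % (a + b)) (q * (a + b) + d) = q * b + (d - a) := by
  have h0 : ∀ d ≤ a + b, Nat.count (fun i => a ≤ i % (a + b)) d = d - a := by
    intro d hd
    induction d with
    | zero => simp
    | succ d ih =>
      rw [Nat.count_succ, ih (by omega), Nat.mod_eq_of_lt (by omega)]
      split_ifs <;> omega
  have hper : ∀ q d, Nat.count (fun i => a ≤ i % (a + b)) (q * (a + b) + d) =
      Nat.count (fun i => a ≤ i % (a + b)) (q * (a + b)) +
        Nat.count (fun i => a ≤ i % (a + b)) d := fun q d => by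
    rw [Nat.count_add]
    simp only [Nat.mul_add_mod_self_right]
  rw [hper, h0 d hd]
  congr 1
  induction q with
  | zero => simp
  | succ q ih =>
    rw [Nat.succ_mul, hper, ih, h0 _ le_rfl, Nat.succ_mul]
    omega

theorem countBelow_catalanSet (n a b q d : ℕ) (hd : d ≤ a + b)
    (h : q * (a + b) + d ≤ n * (a + b)) :
    countBelow (catalanSet n a b) (q * (a + b) + d) = q * b + (d - a) := by
  rw [← count_mod a b q d hd, Nat.count_eq_card_filter_range, countBelow, catalanSet,
    Finset.filter_filter, ← Finset.card_map Fin.valEmbedding]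
  congr 1
  ext i
  simp only [Finset.mem_map, Finset.mem_filter, Finset.mem_univ, true_and, Fin.valEmbedding_apply,
    Finset.mem_range]
  constructor
  · rintro ⟨i, ⟨h1, h2⟩, rfl⟩
    exact ⟨h2, h1⟩
  · exact fun hi => ⟨⟨i, hi.1.trans_le h⟩, ⟨hi.2, hi.1⟩, rfl⟩

theorem card_catalanSet (n a b : ℕ) : (catalanSet n a b).card = n * b := by
  have h := countBelow_catalanSet n a b n 0 (Nat.zero_le _) le_rfl
  rwa [countBelow_eq_card _ (Nat.le_add_right _ 0), Nat.zero_sub, add_zero] at h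

/-- Block boundaries suffice. Inside a block the count of the Catalan set is constant for `a` steps,
where monotonicity from the left boundary applies, and then grows by one per step; the count of `T`
grows no faster, so the inequality at the right boundary propagates backwards. -/
theorem galeLE_catalanSet_iff {n a b : ℕ} (hb : 1 ≤ b) (T : Finset (Fin (n * (a + b)))) :
    GaleLE T (catalanSet n a b) ↔
      T.card = n * b ∧ ∀ q ≤ n, q * b ≤ countBelow T (q * (a + b)) := by
  have hcb : ∀ (U : Finset (Fin (n * (a + b)))) x,
      (U.filter (· ≤ x)).card = countBelow U ((x : ℕ) + 1) := fun U x => by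
    rw [countBelow]
    congr 1
    ext e
    simp only [Finset.mem_filter, Fin.le_def, Nat.lt_succ_iff]
  rw [galeLE_iff, card_catalanSet]
  refine and_congr_right fun hT => ?_
  simp only [hcb]
  constructor
  · intro h q hq
    rcases Nat.eq_zero_or_pos q with rfl | hq0
    · simp
    · have hpos : 0 < q * (a + b) := Nat.mul_pos hq0 (by omega)
      have hle : q * (a + b) ≤ n * (a + b) := Nat.mul_le_mul_right _ hq
      have h1 := h ⟨q * (a + b) - 1, by omega⟩
      have h2 := countBelow_catalanSet n a b q 0 (Nat.zero_le _) hle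
      simp only [Nat.sub_add_cancel hpos] at h1
      simp only [add_zero, Nat.zero_sub] at h2
      omega
  · intro h x
    set q := (x : ℕ) / (a + b) with hq
    set d := (x : ℕ) % (a + b) with hd
    have hm : 0 < a + b := by omega
    have hx : (x : ℕ) = q * (a + b) + d := (Nat.div_add_mod' _ _).symm
    have hdlt : d < a + b := Nat.mod_lt _ hm
    have hqn : q < n := (Nat.div_lt_iff_lt_mul hm).2 x.2
    have hle : (q + 1) * (a + b) ≤ n * (a + b) := Nat.mul_le_mul_right _ hqn
    have h1 := h q hqn.le
    have h2 := h (q + 1) hqn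
    rw [Nat.succ_mul] at hle h2
    rw [Nat.succ_mul q (a + b)] at h2
    have h3 := countBelow_catalanSet n a b q (d + 1) hdlt (by omega)
    have h4 := countBelow_mono T (by omega : q * (a + b) ≤ q * (a + b) + (d + 1))
    have h5 := countBelow_add_le T (q * (a + b) + (d + 1)) (a + b - (d + 1))
    rw [show q * (a + b) + (d + 1) + (a + b - (d + 1)) = q * (a + b) + (a + b) by omega] at h5
    rw [hx, add_assoc, h3]
    omega

/-- The number of elements of `T` from `y` on. -/
def countFrom {N : ℕ} (T : Finset (Fin N)) (y : ℕ) : ℕ := (T.filter fun e : Fin N => y ≤ (e : ℕ)).card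

theorem countBelow_add_countFrom {N : ℕ} (T : Finset (Fin N)) (y : ℕ) :
    countBelow T y + countFrom T y = T.card := by
  rw [countBelow, countFrom, ← Finset.card_filter_add_card_filter_not (s := T)
    (fun e : Fin N => (e : ℕ) < y)]
  simp only [not_lt]

/-- While `I` is too small, take the first boundary `q` where the tail bound is attained. Fewer than
`q * b` elements of `I` lie below it, so some position there is free, and filling it affects only
the bounds at earlier boundaries, which have slack. -/
theorem exists_superset_countFrom_le {n a b : ℕ} (ha : 1 ≤ a) (I : Finset (Fin (n * (a + b))))
    (hI : ∀ q ≤ n, countFrom I (q * (a + b)) ≤ (n - q) * b) :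
    ∃ T, I ⊆ T ∧ T.card = n * b ∧ ∀ q ≤ n, countFrom T (q * (a + b)) ≤ (n - q) * b := by
  induction hk : n * b - I.card generalizing I with
  | zero =>
    have h0 := hI 0 (Nat.zero_le n)
    have h1 := countBelow_add_countFrom I (0 * (a + b))
    rw [countBelow, Finset.filter_false_of_mem (by simp), Finset.card_empty] at h1
    rw [Nat.sub_zero] at h0
    exact ⟨I, subset_rfl, by omega, hI⟩
  | succ k ih =>
    -- The bound at `q = n` is `0 ≤ 0`, so it is always attained.
    have hex : ∃ q, q ≤ n ∧ countFrom I (q * (a + b)) = (n - q) * b := by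
      refine ⟨n, le_rfl, ?_⟩
      have := hI n le_rfl
      rw [Nat.sub_self, zero_mul] at *
      omega
    obtain ⟨hqn, hq⟩ := Nat.find_spec hex
    set q := Nat.find hex with hqdef
    have hsplit : (n - q) * b + q * b = n * b := by
      rw [← Nat.add_mul, Nat.sub_add_cancel hqn]
    have h1 := countBelow_add_countFrom I (q * (a + b))
    have h2 : countBelow I (q * (a + b)) < q * (a + b) := by
      have : q * b ≤ q * (a + b) := Nat.mul_le_mul_left _ (by omega)
      omega
    obtain ⟨e, he, heI⟩ : ∃ e : Fin (n * (a + b)), (e : ℕ) < q * (a + b) ∧ e ∉ I := by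
      by_contra! hall
      have hle : q * (a + b) ≤ n * (a + b) := Nat.mul_le_mul_right _ hqn
      have h3 : (Finset.univ.filter fun e : Fin (n * (a + b)) => (e : ℕ) < q * (a + b)) ⊆
          I.filter fun e : Fin (n * (a + b)) => (e : ℕ) < q * (a + b) := fun e he => by
        rw [Finset.mem_filter] at he ⊢
        exact ⟨hall e he.2, he.2⟩
      have h4 := Finset.card_le_card h3
      rw [Fin.card_filter_val_lt, min_eq_right hle] at h4
      exact absurd h2 (not_lt.2 h4)
    have hins : ∀ q' ≤ n, countFrom (insert e I) (q' * (a + b)) ≤ (n - q') * b := by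
      intro q' hq'
      have h3 := hI q' hq'
      rw [countFrom, Finset.filter_insert]
      split_ifs with hle
      · have hlt : q' < q := lt_of_mul_lt_mul_right (hle.trans_lt he) (Nat.zero_le _)
        have h4 : countFrom I (q' * (a + b)) ≠ (n - q') * b := fun h =>
          Nat.find_min hex hlt ⟨hq', h⟩
        refine (Finset.card_insert_le _ _).trans ?_
        unfold countFrom at h3 h4
        omega
      · exact h3
    obtain ⟨T, hT, hT'⟩ := ih (insert e I) hins (by
      rw [Finset.card_insert_of_notMem heI]
      omega)
    exact ⟨T, (Finset.subset_insert e I).trans hT, hT'⟩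

theorem isBase_catalanMatroid_iff {n a b : ℕ} (hb : 1 ≤ b) (T : Finset (Fin (n * (a + b)))) :
    (catalanMatroid n a b).IsBase T ↔
      T.card = n * b ∧ ∀ q ≤ n, countFrom T (q * (a + b)) ≤ (n - q) * b := by
  have h1 : (catalanMatroid n a b).IsBase T ↔ GaleLE T (catalanSet n a b) := by
    constructor
    · rintro ⟨U, hU, h⟩
      rwa [← Finset.coe_injective hU]
    · exact fun h => ⟨T, rfl, h⟩
  rw [h1, galeLE_catalanSet_iff hb]
  refine and_congr_right fun hT => forall₂_congr fun q hq => ?_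
  have h2 := countBelow_add_countFrom T (q * (a + b))
  have h3 : (n - q) * b + q * b = n * b := by rw [← Nat.add_mul, Nat.sub_add_cancel hq]
  omega

theorem indep_catalanMatroid {n a b : ℕ} (ha : 1 ≤ a) (hb : 1 ≤ b)
    (I : Finset (Fin (n * (a + b))))
    (hI : ∀ q ≤ n, countFrom I (q * (a + b)) ≤ (n - q) * b) :
    (catalanMatroid n a b).Indep I := by
  obtain ⟨T, hIT, hT⟩ := exists_superset_countFrom_le ha I hI
  exact ((isBase_catalanMatroid_iff hb T).2 hT).indep.subset (Finset.coe_subset.2 hIT)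

theorem setRk_catalanMatroid_le {n a b : ℕ} (hb : 1 ≤ b) (A : Set (Fin (n * (a + b)))) {q : ℕ}
    (hq : q ≤ n) :
    setRk (catalanMatroid n a b) A ≤
      {e | e ∈ A ∧ (e : ℕ) < q * (a + b)}.ncard + (n - q) * b := by
  classical
  obtain ⟨I, hI, hIA, hr⟩ := exists_isBasis_setRk (catalanMatroid n a b) rfl A
  obtain ⟨B, hB, hIB⟩ := hI.exists_isBase_superset
  have hB' := (isBase_catalanMatroid_iff hb B.toFinset).1 (by rwa [Set.coe_toFinset])
  rw [← hr, Set.ncard_eq_toFinset_card', ← countBelow_add_countFrom _ (q * (a + b))]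
  refine add_le_add ?_ ((Finset.card_le_card ?_).trans (hB'.2 q hq))
  · rw [Set.ncard_eq_toFinset_card']
    refine Finset.card_le_card fun e he => ?_
    rw [Finset.mem_filter, Set.mem_toFinset] at he
    exact Set.mem_toFinset.2 ⟨hIA he.1, he.2⟩
  · exact Finset.filter_subset_filter _ (Set.toFinset_subset_toFinset.2 hIB)

/-- The blocks are laid out in the reverse of the order of `L`, because the Catalan matroid bounds
final segments while the nested description bounds prefixes of `L`. -/
theorem exists_orderingEquiv {n m : ℕ} {L : List (Fin n)} (hL : L ∈ orderings Finset.univ) :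
    ∃ e : Fin n × Fin m ≃ Fin (n * m), ∀ x, ∀ j ≤ n,
      (n - j) * m ≤ (e x : ℕ) ↔ x.1 ∈ L.take j := by
  obtain ⟨hnodup, hmem⟩ := mem_orderings.1 hL
  have hall : ∀ i, i ∈ L := fun i => (hmem i).2 (Finset.mem_univ i)
  have hlen : L.length = n := by
    rw [← List.toFinset_card_of_nodup hnodup, toFinset_of_mem_orderings hL, Finset.card_univ,
      Fintype.card_fin]
  let g : Fin n ≃ Fin n :=
    ((hnodup.getEquivOfForallMemList L hall).symm.trans (finCongr hlen)).trans Fin.revPerm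
  have hg : ∀ i, (g i : ℕ) = n - (L.idxOf i + 1) := fun i => rfl
  refine ⟨(g.prodCongr (Equiv.refl _)).trans finProdFinEquiv, fun x j hj => ?_⟩
  have hidx : L.idxOf x.1 < n := (List.idxOf_lt_length_of_mem (hall x.1)).trans_eq hlen
  have he : (((g.prodCongr (Equiv.refl _)).trans finProdFinEquiv x : Fin (n * m)) : ℕ) =
      (x.2 : ℕ) + m * (g x.1 : ℕ) := rfl
  rw [List.mem_take_iff_idxOf_lt (hall x.1), he, hg, ← Nat.le_div_iff_mul_le (by
    have := x.2.2
    omega), Nat.add_mul_div_left _ _ (by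
    have := x.2.2
    omega), Nat.div_eq_of_lt x.2.2]
  omega

end Ranks

/-! ### The `Z`-polynomial of the Catalan matroid -/

section Main

theorem setRk_catalanMatroid_univ {n a b : ℕ} (hb : 1 ≤ b) :
    setRk (catalanMatroid n a b) Set.univ = n * b := by
  refine le_antisymm ?_ ?_
  · simpa using setRk_catalanMatroid_le hb Set.univ (Nat.zero_le n)
  · have hB : (catalanMatroid n a b).IsBase (catalanSet n a b : Set (Fin (n * (a + b)))) :=
      ⟨catalanSet n a b, rfl, rfl, fun _ => le_rfl⟩
    have h := (ncard_le_setRk_of_indep hB.indep).trans (setRk_mono _ (Set.subset_univ _))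
    rwa [Set.ncard_coe_finset, card_catalanSet] at h

theorem partitionRank_univ {ι β : Type*} [Fintype ι] [Fintype β] [DecidableEq ι]
    {P : Finset (Finset ι)} (hP : P ∈ setPartitions Finset.univ) {b : ℕ}
    (hb : b ≤ Fintype.card β) :
    partitionRank (β := β) b P Set.univ = Fintype.card ι * b := by
  have hY : ∀ Y : Finset ι, (inBlocks (Set.univ : Set (ι × β)) (· ∈ Y)).ncard =
      Y.card * Fintype.card β := by
    intro Y
    rw [← Finset.card_univ, ← Finset.card_product, ← Set.ncard_coe_finset]
    congr 1
    ext x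
    simp [mem_inBlocks]
  have h : ∀ Y ∈ P, min (inBlocks (Set.univ : Set (ι × β)) (· ∈ Y)).ncard (b * Y.card) =
      ∑ _i ∈ Y, b := by
    intro Y _
    rw [hY, min_eq_right, Finset.sum_const, smul_eq_mul, mul_comm]
    rw [mul_comm]
    exact Nat.mul_le_mul_left _ hb
  rw [partitionRank, Finset.sum_congr rfl h, sum_sum_setPartitions hP, Finset.sum_const,
    Finset.card_univ, smul_eq_mul]

/-- The `n!` orderings give relabelled copies of one matroid, all with the same `Z`-polynomial, so
the sum over orderings collapses to the left-hand side. -/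
theorem factorial_mul_zPoly_catalanMatroid {n a b : ℕ} (ha : 1 ≤ a) (hb : 1 ≤ b) :
    (n.factorial : ℤ[X]) * zPoly (catalanMatroid n a b) =
      ∑ P ∈ setPartitions (Finset.univ : Finset (Fin n)),
        (cycleWeight P : ℤ[X]) * ∏ Y ∈ P, zPoly (uniformAB Y.card a b) := by
  classical
  have : Nonempty (Fin n × Fin (a + b) ≃ Fin (n * (a + b))) := ⟨finProdFinEquiv⟩
  choose! e he using fun (L : List (Fin n)) (hL : L ∈ orderings Finset.univ) =>
    exists_orderingEquiv (m := a + b) hL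
  choose! p hp hz using fun (P : Finset (Finset (Fin n))) (hP : P ∈ setPartitions Finset.univ) =>
    exists_isKL_partitionRank (β := Fin (a + b)) hP a b (Fintype.card_fin _)
  set M := catalanMatroid n a b with hM
  have hlen : ∀ L ∈ orderings (Finset.univ : Finset (Fin n)), L.length = n := fun L hL => by
    rw [← List.toFinset_card_of_nodup (mem_orderings.1 hL).1, toFinset_of_mem_orderings hL,
      Finset.card_univ, Fintype.card_fin]
  have hab : b ≤ Fintype.card (Fin (a + b)) := by simp
  have hindep : ∀ L ∈ orderings (Finset.univ : Finset (Fin n)), ∀ I : Set (Fin n × Fin (a + b)),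
      (∀ T, T <+: L → (inBlocks I (· ∈ T)).ncard ≤ b * T.length) →
        I.ncard ≤ setRk M (e L '' I) := by
    intro L hL I hI
    have hind : M.Indep ((e L '' I).toFinset : Set (Fin (n * (a + b)))) := by
      refine indep_catalanMatroid ha hb _ fun q hq => ?_
      have h1 := hI (L.take (n - q)) (List.take_prefix _ _)
      rw [List.length_take, hlen L hL, min_eq_left (Nat.sub_le n q), mul_comm] at h1
      refine le_of_eq_of_le ?_ h1
      rw [countFrom, ← Set.ncard_coe_finset, ← Set.ncard_image_of_injective _ (e L).injective]
      congr 1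
      ext x
      obtain ⟨x, rfl⟩ := (e L).surjective x
      have h2 := he L hL x (n - q) (Nat.sub_le n q)
      rw [Nat.sub_sub_self hq] at h2
      rw [(e L).injective.mem_set_image, mem_inBlocks, ← h2, Finset.mem_coe, Finset.mem_filter,
        Set.mem_toFinset, (e L).injective.mem_set_image]
    rw [Set.coe_toFinset] at hind
    rw [← Set.ncard_image_of_injective I (e L).injective]
    exact ncard_le_setRk_of_indep hind
  have hle : ∀ L ∈ orderings (Finset.univ : Finset (Fin n)), ∀ A : Set (Fin n × Fin (a + b)),
      ∀ T, T <+: L → setRk M (e L '' A) ≤ (inBlocks A (· ∉ T)).ncard + b * T.length := by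
    intro L hL A T hT
    have hTn : T.length ≤ n := hT.length_le.trans_eq (hlen L hL)
    have h1 := setRk_catalanMatroid_le hb (e L '' A) (Nat.sub_le n T.length)
    rw [Nat.sub_sub_self hTn, mul_comm T.length] at h1
    refine h1.trans_eq ?_
    rw [← Set.ncard_image_of_injective (inBlocks A _) (e L).injective]
    congr 2
    ext x
    obtain ⟨x, rfl⟩ := (e L).surjective x
    have h2 := he L hL x T.length hTn
    rw [← List.prefix_iff_eq_take.1 hT] at h2
    simp [mem_inBlocks, ← h2]
  have hmono : ∀ L ∈ orderings (Finset.univ : Finset (Fin n)),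
      Monotone fun A => setRk M (e L '' A) := fun L _ A B hAB =>
    setRk_mono M (Set.image_mono hAB)
  have hchain := sum_orderings_eq_sum_setPartitions hab
    (r := fun L A => setRk M (e L '' A)) hindep hmono hle
  -- Orderings with coefficient 1 and set partitions with minus their weight form one relation
  -- between rank functions of common total rank `n * b`.
  have key := sum_zeta_eq_zero
    (s := (orderings (Finset.univ : Finset (Fin n))).disjSum (setPartitions Finset.univ))
    (c := Sum.elim (fun _ => 1) fun P => -(cycleWeight P : ℤ))
    (r := Sum.elim (fun L A => setRk M (e L '' A)) (partitionRank b))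
    (p := Sum.elim (fun L A => klPoly (M ／ (e L '' A))) p) (R := n * b) ?_ ?_ ?_
  · rw [Finset.sum_disjSum] at key
    simp only [Sum.elim_inl, Sum.elim_inr] at key
    have h1 : ∀ L ∈ orderings (Finset.univ : Finset (Fin n)),
        C 1 * zeta (fun A => setRk M (e L '' A)) (fun A => klPoly (M ／ (e L '' A))) =
          zPoly M := fun L _ => by
      rw [C_1, one_mul, zPoly_eq_zeta M rfl]
      exact zeta_comp_equiv (setRk M) (fun A => klPoly (M ／ A)) (e L)
    have h2 : ∀ P ∈ setPartitions (Finset.univ : Finset (Fin n)),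
        C (-(cycleWeight P : ℤ)) * zeta (partitionRank b P) (p P) =
          -((cycleWeight P : ℤ[X]) * ∏ Y ∈ P, zPoly (uniformAB Y.card a b)) := fun P hP => by
      rw [hz P hP, C_neg, neg_mul]
      simp
    rw [Finset.sum_congr rfl h1, Finset.sum_congr rfl h2, Finset.sum_const, card_orderings,
      Finset.card_univ, Fintype.card_fin, nsmul_eq_mul, Finset.sum_neg_distrib] at key
    exact add_neg_eq_zero.1 key
  · rintro (L | P) hk
    · exact (isKL_matroid M rfl).comp_equiv (e L)
    · exact hp P (Finset.inr_mem_disjSum.1 hk)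
  · rintro (L | P) hk
    · simp only [Sum.elim_inl, Set.image_univ, EquivLike.range_eq_univ]
      exact setRk_catalanMatroid_univ hb
    · rw [Sum.elim_inr, partitionRank_univ (Finset.inr_mem_disjSum.1 hk) hab, Fintype.card_fin]
  · intro 𝒞 h𝒞 Φ hΦ
    rw [Finset.sum_disjSum]
    simp only [Sum.elim_inl, Sum.elim_inr, one_mul, neg_mul, Finset.sum_neg_distrib]
    rw [hchain 𝒞 h𝒞 Φ hΦ, add_neg_cancel]

end Main

theorem corollary4p6 (n a b : ℕ) (ha : 1 ≤ a) (hb : 1 ≤ b) :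
    (zPoly (catalanMatroid n a b)).map (Int.castRingHom ℚ) =
        ∑ lam : n.Partition,
          C (1 / (zFactor lam : ℚ)) * (zPoly (uniformSum a b lam)).map (Int.castRingHom ℚ) ∧
      ∀ lam : n.Partition,
        zPoly (uniformSum a b lam) = (lam.parts.map fun i => zPoly (uniformAB i a b)).prod := by
  refine ⟨?_, zPoly_uniformSum a b⟩
  set z : ℕ → ℚ[X] := fun i => (zPoly (uniformAB i a b)).map (Int.castRingHom ℚ) with hz
  have h1 := congrArg (Polynomial.mapRingHom (Int.castRingHom ℚ))
    (factorial_mul_zPoly_catalanMatroid (n := n) ha hb)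
  simp only [map_mul, map_sum, map_prod, map_natCast, coe_mapRingHom] at h1
  -- The exponential formula turns the set-partition sum into `n!` times the sum over integer
  -- partitions; cancelling `n!` is why the coefficients are rational.
  rw [sum_cycleWeight_mul_prod z (sumOverPartitions z) (sumOverPartitions_zero z)
    (sumOverPartitions_succ z), Finset.card_univ, Fintype.card_fin] at h1
  rw [mul_left_cancel₀ (Nat.cast_ne_zero.2 n.factorial_ne_zero) h1, sumOverPartitions]
  refine Finset.sum_congr rfl fun lam _ => ?_
  rw [zPoly_uniformSum, ← coe_mapRingHom, map_multiset_prod, Multiset.map_map]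
  rfl
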